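/- Let $A\in\mathbb{R}^{d\times d}$ and let $\Phi(t,x)=e^{tA}x$ be the flow of $\dot x=Ax$ on $\mathbb{R}^d$ (with the Euclidean norm). For an eigenvalue $\mu\in\mathbb{C}$ of $A$ let $E(\mu)\subset\mathbb{R}^d$ be the real generalized eigenspace, i.e. the real span of the real and imaginary parts of the complex generalized eigenvectors for $\mu$, and let $$V:=\bigoplus\{E(\mu)\mid \mu\in\mathrm{spec}(A),\ \operatorname{Re}\mu=0\}$$ (a pair of complex conjugate eigenvalues, for which $E(\mu)=E(\bar\mu)$, is counted once). Assume $V\neq\{0\}$. Conventions. For a flow $\Psi$ on a metric space $X$ and $\varepsilon,T>0$, an $(\varepsilon,T)$-chain from $x$ to $y$ is given by $n\ge 1$, times $T_0,\dots,T_{n-1}\ge T$ and points $x_0=x,\dots,x_n=y$ in $X$ with $d(\Psi(T_i,x_i),x_{i+1})<\varepsilon$ for $0\le i<n$. A set $M\subset X$ is chain transitive if for all $x,y\in M$ and all $\varepsilon,T>0$ there is an $(\varepsilon,T)$-chain from $x$ to $y$; a chain recurrent component is a maximal nonempty chain transitive set. $\Phi$ induces a flow on projective space $\mathbb{P}^{d-1}$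 (with the metric $d(\mathbb{P}v,\mathbb{P}w)=\min(\|v-w\|,\|v+w\|)$ for unit vectors $v,w$) and the flow $v\mapsto \Phi(t,v)/\|\Phi(t,v)\|$ on the unit sphere $\mathbb{S}^{d-1}$. The flow $(v,r)\mapsto(\Phi(t,v),r)$ on $\mathbb{R}^d\times\mathbb{R}$ induces in the same way a flow on its unit sphere $\mathbb{S}^d$ (the Poincaré sphere), which leaves invariant the closed upper hemisphere $\overline{\mathbb{S}^{d,+}}=\{(v,r)\in\mathbb{S}^d\mid r\ge 0\}$; let $\pi_P(v)=(v,1)/\|(v,1)\|$ for $v\in\mathbb{R}^d$. A cone is a set $K\subset\mathbb{R}^d\setminus\{0\}$ with $\alpha K\subset K$ for all $\alpha>0$. Then: (1) The projection ${}_{\mathbb{P}}M$ of $V$ to $\mathbb{P}^{d-1}$ is a chain recurrent component of the induced flow on $\mathbb{P}^{d-1}$. (2) There are exactly one or two cones $K$ such that $K\cap\mathbb{S}^{d-1}$ is a chain recurrent component of the induced flow on $\mathbb{S}^{d-1}$ which projects onto ${}_{\mathbb{P}}M$; denote them by $V^+$ and $V^-$ (where $V^+=V^-$ if there is only one). (3)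 For each of $V^\pm$ the closure of $\pi_PV^{\pm}$ is chain transitive for the induced flow on the closed upper hemisphere $\overline{\mathbb{S}^{d,+}}$ of the Poincaré sphere. -/

import Mathlib

open scoped LinearAlgebra.Projectivization

noncomputable section

/-! ### Chains, chain limit sets, chain transitivity -/

section Chains

variable {X : Type*} [MetricSpace X]

/-- There is an `(ε, T)`-chain from `a` to `b`: points `x 0 = a, …, x n = b` with `n ≥ 1`
and times `τ 0, …, τ (n - 1) ≥ T` with `d(Ψ(τ i, x i), x (i + 1)) < ε`. -/
def ExistsChain (Ψ : Flow ℝ X) (ε T : ℝ) (a b : X) : Prop :=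
  ∃ (n : ℕ) (τ : ℕ → ℝ) (x : ℕ → X), 1 ≤ n ∧ x 0 = a ∧ x n = b ∧
    ∀ i < n, T ≤ τ i ∧ dist (Ψ (τ i) (x i)) (x (i + 1)) < ε

/-- The (forward) chain limit set `Ω(a)`. -/
def chainLimitSet (Ψ : Flow ℝ X) (a : X) : Set X :=
  {b | ∀ ε > 0, ∀ T > 0, ExistsChain Ψ ε T a b}

/-- A set is chain transitive if `b ∈ Ω(a)` for all `a, b` in it (the chains may leave the set). -/
def IsChainTransitive (Ψ : Flow ℝ X) (M : Set X) : Prop :=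
  ∀ a ∈ M, ∀ b ∈ M, b ∈ chainLimitSet Ψ a

/-- A chain recurrent component is a maximal (nonempty) chain transitive set. -/
def IsChainRecurrentComponent (Ψ : Flow ℝ X) (M : Set X) : Prop :=
  M.Nonempty ∧ Maximal (IsChainTransitive Ψ) M

end Chains

/-! ### Linear flows and the induced flows on the unit sphere and on projective space -/

/-- A continuous flow by linear maps on a real normed space. -/
structure LinearFlow (F : Type*) [NormedAddCommGroup F] [NormedSpace ℝ F] extends Flow ℝ F where
  isLinearMap' : ∀ t, IsLinearMap ℝ (toFun t)

section Induced

variable {F : Type*} [NormedAddCommGroup F] [NormedSpace ℝ F]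

namespace LinearFlow

theorem injective (φ : LinearFlow F) (t : ℝ) : Function.Injective (φ.toFun t) := by
  intro v w h
  have h' := congrArg (φ.toFun (-t)) h
  rwa [← φ.map_add', ← φ.map_add', neg_add_cancel, φ.map_zero', φ.map_zero'] at h'

theorem apply_ne_zero (φ : LinearFlow F) (t : ℝ) {v : F} (hv : v ≠ 0) : φ.toFun t v ≠ 0 := by
  intro h
  exact hv (φ.injective t (h.trans (φ.isLinearMap' t).map_zero.symm))

/-- The flow `v ↦ φ(t, v) / ‖φ(t, v)‖` on the unit sphere. -/
def sphereFlow (φ : LinearFlow F) : Flow ℝ (Metric.sphere (0 : F) 1) where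
  toFun t v := ⟨‖φ.toFun t v‖⁻¹ • φ.toFun t v, by
    have h := φ.apply_ne_zero t (ne_zero_of_mem_unit_sphere v)
    rw [mem_sphere_zero_iff_norm, norm_smul, norm_inv, norm_norm,
      inv_mul_cancel₀ (norm_ne_zero_iff.2 h)]⟩
  cont' := by
    have hc : Continuous fun p : ℝ × Metric.sphere (0 : F) 1 => φ.toFun p.1 p.2 :=
      φ.cont'.comp (continuous_fst.prodMk (continuous_subtype_val.comp continuous_snd))
    refine Continuous.subtype_mk ?_ _
    exact (hc.norm.inv₀ fun p => norm_ne_zero_iff.2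
      (φ.apply_ne_zero p.1 (ne_zero_of_mem_unit_sphere p.2))).smul hc
  map_add' t s v := by
    have h := φ.apply_ne_zero s (ne_zero_of_mem_unit_sphere v)
    have h0 := norm_ne_zero_iff.2 h
    apply Subtype.ext
    simp only [φ.map_add', (φ.isLinearMap' t).map_smul, norm_smul, norm_inv, norm_norm, mul_inv,
      inv_inv, smul_smul]
    congr 1
    field_simp
  map_zero' v := by
    apply Subtype.ext
    simp [φ.map_zero']

end LinearFlow

/-- The projection of the unit sphere onto projective space. -/
def sphereToProj (v : Metric.sphere (0 : F) 1) : ℙ ℝ F :=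
  Projectivization.mk ℝ (v : F) (ne_zero_of_mem_unit_sphere v)

theorem sphereToProj_eq_iff {v w : Metric.sphere (0 : F) 1} :
    sphereToProj v = sphereToProj w ↔ v = w ∨ v = -w := by
  unfold sphereToProj
  rw [Projectivization.mk_eq_mk_iff']
  constructor
  · rintro ⟨a, ha⟩
    have h1 : ‖(v : F)‖ = 1 := norm_eq_of_mem_sphere v
    rw [← ha, norm_smul, norm_eq_of_mem_sphere w, mul_one, Real.norm_eq_abs] at h1
    rcases eq_or_eq_neg_of_abs_eq h1 with rfl | rfl
    · exact Or.inl (Subtype.ext (by simpa using ha.symm))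
    · exact Or.inr (Subtype.ext (by simpa using ha.symm))
  · rintro (rfl | rfl)
    · exact ⟨1, one_smul _ _⟩
    · exact ⟨-1, by simp⟩

theorem sphereToProj_surjective : Function.Surjective (sphereToProj (F := F)) := by
  intro p
  induction p with
  | h v hv =>
    refine ⟨⟨‖v‖⁻¹ • v, ?_⟩, ?_⟩
    · rw [mem_sphere_zero_iff_norm, norm_smul, norm_inv, norm_norm,
        inv_mul_cancel₀ (norm_ne_zero_iff.2 hv)]
    · exact (Projectivization.mk_eq_mk_iff' ℝ _ _ _ _).2 ⟨‖v‖⁻¹, rfl⟩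

/-- A unit vector on the line `p`. -/
def unitRep (p : ℙ ℝ F) : Metric.sphere (0 : F) 1 := (sphereToProj_surjective p).choose

theorem sphereToProj_unitRep (p : ℙ ℝ F) : sphereToProj (unitRep p) = p :=
  (sphereToProj_surjective p).choose_spec

/-- The metric of projective space: `d(ℙv, ℙw) = min ‖v - w‖ ‖v + w‖` for unit vectors `v, w`. -/
instance projMetricSpace : MetricSpace (ℙ ℝ F) where
  dist p q := min (dist (unitRep p) (unitRep q)) (dist (unitRep p) (-unitRep q))
  dist_self p := by simp
  dist_comm p q := by
    have h : dist (unitRep p) (-unitRep q) = dist (unitRep q) (-unitRep p) := by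
      simp only [Subtype.dist_eq, dist_eq_norm, coe_neg_sphere, sub_neg_eq_add]
      rw [add_comm]
    rw [dist_comm (unitRep p) (unitRep q), h]
  dist_triangle p q r := by
    have key : ∀ a b c : Metric.sphere (0 : F) 1,
        min (dist a c) (dist a (-c)) ≤
          min (dist a b) (dist a (-b)) + min (dist b c) (dist b (-c)) := by
      intro a b c
      have hn : ∀ x y : Metric.sphere (0 : F) 1, dist (-x) (-y) = dist x y := by
        intro x y
        simp [Subtype.dist_eq]
      have h1 := dist_triangle a b c
      have h2 := dist_triangle a b (-c)
      have h3 := dist_triangle a (-b) (-c)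
      have h4 := dist_triangle a (-b) c
      have h5 := hn b (-c)
      rw [hn] at h3
      rw [neg_neg] at h5
      have m1 := min_le_left (dist a c) (dist a (-c))
      have m2 := min_le_right (dist a c) (dist a (-c))
      rcases min_choice (dist a b) (dist a (-b)) with e | e <;>
      rcases min_choice (dist b c) (dist b (-c)) with e' | e' <;>
      rw [e, e'] <;> linarith
    exact key _ _ _
  eq_of_dist_eq_zero := by
    intro p q h
    have h' : min (dist (unitRep p) (unitRep q)) (dist (unitRep p) (-unitRep q)) = 0 := h
    rw [← sphereToProj_unitRep p, ← sphereToProj_unitRep q, sphereToProj_eq_iff]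
    rcases min_choice (dist (unitRep p) (unitRep q)) (dist (unitRep p) (-unitRep q)) with e | e
    · exact Or.inl (dist_eq_zero.1 (e ▸ h'))
    · exact Or.inr (dist_eq_zero.1 (e ▸ h'))

theorem dist_sphereToProj (v w : Metric.sphere (0 : F) 1) :
    dist (sphereToProj v) (sphereToProj w) = min ‖(v : F) - w‖ ‖(v : F) + w‖ := by
  have h : dist (sphereToProj v) (sphereToProj w) =
      min (dist (unitRep (sphereToProj v)) (unitRep (sphereToProj w)))
        (dist (unitRep (sphereToProj v)) (-unitRep (sphereToProj w))) := rfl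
  rw [h]
  rcases sphereToProj_eq_iff.1 (sphereToProj_unitRep (sphereToProj v)) with e | e <;>
  rcases sphereToProj_eq_iff.1 (sphereToProj_unitRep (sphereToProj w)) with e' | e' <;>
  rw [e, e'] <;> simp only [Subtype.dist_eq, dist_eq_norm, coe_neg_sphere, sub_neg_eq_add]
  · rw [min_comm, ← sub_eq_add_neg]
  · rw [← norm_neg (-(v : F) - w), ← norm_neg (-(v : F) + w), min_comm, neg_sub, neg_add,
      neg_neg, sub_neg_eq_add, sub_eq_add_neg, add_comm (w : F)]
  · rw [← norm_neg (-(v : F) + w), ← norm_neg (-(v : F) + -w), neg_add, neg_add, neg_neg,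
      neg_neg, sub_eq_add_neg]

/-- The metric of projective space induces the quotient topology. -/
theorem isOpenQuotientMap_sphereToProj : IsOpenQuotientMap (sphereToProj (F := F)) := by
  refine ⟨sphereToProj_surjective, ?_, ?_⟩
  · refine Metric.continuous_iff.2 fun v ε hε => ⟨ε, hε, fun w hw => ?_⟩
    rw [dist_sphereToProj]
    rw [Subtype.dist_eq, dist_eq_norm] at hw
    exact (min_le_left _ _).trans_lt hw
  · intro U hU
    refine Metric.isOpen_iff.2 ?_
    rintro _ ⟨v, hv, rfl⟩
    obtain ⟨ε, hε, hb⟩ := Metric.isOpen_iff.1 hU v hv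
    refine ⟨ε, hε, fun p hp => ?_⟩
    obtain ⟨w, rfl⟩ := sphereToProj_surjective p
    rw [Metric.mem_ball, dist_sphereToProj, min_lt_iff] at hp
    rcases hp with hp | hp
    · exact ⟨w, hb (by rwa [Metric.mem_ball, Subtype.dist_eq, dist_eq_norm]), rfl⟩
    · refine ⟨-w, hb ?_, sphereToProj_eq_iff.2 (Or.inr rfl)⟩
      rw [Metric.mem_ball, Subtype.dist_eq, dist_eq_norm, coe_neg_sphere, ← norm_neg,
        neg_sub, sub_neg_eq_add, add_comm]
      exact hp

namespace LinearFlow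

/-- The flow `ℙv ↦ ℙ(φ(t, v))` on projective space. -/
def projFlow (φ : LinearFlow F) : Flow ℝ (ℙ ℝ F) where
  toFun t := Projectivization.map ((φ.isLinearMap' t).mk' (φ.toFun t)) (φ.injective t)
  cont' := by
    refine ((IsOpenQuotientMap.id (X := ℝ)).prodMap
      (isOpenQuotientMap_sphereToProj (F := F))).isQuotientMap.continuous_iff.2 ?_
    have h := (isOpenQuotientMap_sphereToProj (F := F)).continuous.comp φ.sphereFlow.cont'
    refine h.congr ?_
    rintro ⟨t, v⟩
    exact (Projectivization.mk_eq_mk_iff' ℝ _ _ _ _).2 ⟨‖φ.toFun t v‖⁻¹, rfl⟩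
  map_add' t s p := by
    induction p with
    | h v hv =>
      exact (Projectivization.mk_eq_mk_iff' ℝ _ _ _ _).2
        ⟨1, (one_smul _ _).trans (φ.map_add' t s v).symm⟩
  map_zero' p := by
    induction p with
    | h v hv =>
      exact (Projectivization.mk_eq_mk_iff' ℝ _ _ _ _).2
        ⟨1, (one_smul _ _).trans (φ.map_zero' v).symm⟩

end LinearFlow

/-! ### The Poincaré sphere -/

/-- The linear flow `(v, r) ↦ (φ(t, v), r)` on `F × ℝ` (with the Euclidean product norm). -/
def LinearFlow.extend (φ : LinearFlow F) : LinearFlow (WithLp 2 (F × ℝ)) where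
  toFun t z := WithLp.toLp 2 (φ.toFun t z.fst, z.snd)
  cont' := by
    refine (WithLp.prod_continuous_toLp 2 F ℝ).comp ?_
    refine Continuous.prodMk (φ.cont'.comp (continuous_fst.prodMk ?_)) ?_
    · exact (WithLp.continuous_fst 2 F ℝ).comp continuous_snd
    · exact (WithLp.continuous_snd 2 F ℝ).comp continuous_snd
  map_add' t s z := by simp [φ.map_add']
  map_zero' z := by
    apply WithLp.ofLp_injective
    simp [φ.map_zero']
    rfl
  isLinearMap' t := by
    constructor
    · intro x y
      apply WithLp.ofLp_injective
      simp [(φ.isLinearMap' t).map_add]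
    · intro c x
      apply WithLp.ofLp_injective
      simp [(φ.isLinearMap' t).map_smul]

variable (F) in
/-- The closed upper hemisphere `{(v, r) | ‖(v, r)‖ = 1, r ≥ 0}` of the Poincaré sphere, the unit
sphere of `F × ℝ`. -/
def closedUpperHemisphere : Set (Metric.sphere (0 : WithLp 2 (F × ℝ)) 1) :=
  {z | 0 ≤ (z : WithLp 2 (F × ℝ)).snd}

theorem isInvariant_closedUpperHemisphere (φ : LinearFlow F) :
    IsInvariant φ.extend.sphereFlow.toFun (closedUpperHemisphere F) := by
  intro t z hz
  exact mul_nonneg (inv_nonneg.2 (norm_nonneg _)) hz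

/-- The flow induced by `φ` on the closed upper hemisphere of the Poincaré sphere. -/
def LinearFlow.hemisphereFlow (φ : LinearFlow F) : Flow ℝ (closedUpperHemisphere F) :=
  φ.extend.sphereFlow.restrict (isInvariant_closedUpperHemisphere φ)

/-- The central projection `π_P(v) = (v, 1) / ‖(v, 1)‖` to the Poincaré sphere. -/
def poincareProj (v : F) : closedUpperHemisphere F :=
  ⟨⟨‖WithLp.toLp 2 (v, (1 : ℝ))‖⁻¹ • WithLp.toLp 2 (v, (1 : ℝ)), by
    have h : ‖WithLp.toLp 2 (v, (1 : ℝ))‖ ≠ 0 := by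
      refine norm_ne_zero_iff.2 fun h => ?_
      have := congrArg WithLp.snd h
      simp at this
    rw [mem_sphere_zero_iff_norm, norm_smul, norm_inv, norm_norm, inv_mul_cancel₀ h]⟩,
    mul_nonneg (inv_nonneg.2 (norm_nonneg _)) zero_le_one⟩

/-- A cone: a set of nonzero vectors that is closed under multiplication by positive scalars. -/
def IsPositiveCone (K : Set F) : Prop :=
  (0 : F) ∉ K ∧ ∀ c : ℝ, 0 < c → ∀ v ∈ K, c • v ∈ K

/-- The intersection of `K` with the unit sphere, as a set of points of the sphere. -/
def sphereSection (K : Set F) : Set (Metric.sphere (0 : F) 1) :=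
  {v | (v : F) ∈ K}

/-- The flow `(t, x) ↦ exp(tL) x` of the linear differential equation `ẋ = L x`. -/
def expFlow [CompleteSpace F] (L : F →L[ℝ] F) : LinearFlow F where
  toFun t x := NormedSpace.exp (t • L) x
  cont' := by
    let _ : NormedAlgebra ℚ (F →L[ℝ] F) := NormedAlgebra.restrictScalars ℚ ℝ _
    refine Continuous.clm_apply (NormedSpace.exp_continuous.comp ?_) continuous_snd
    exact continuous_fst.smul continuous_const
  map_add' t s x := by
    let _ : NormedAlgebra ℚ (F →L[ℝ] F) := NormedAlgebra.restrictScalars ℚ ℝ _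
    rw [add_smul, NormedSpace.exp_add_of_commute (((Commute.refl L).smul_left t).smul_right s)]
    rfl
  map_zero' x := by
    rw [zero_smul, NormedSpace.exp_zero]
    rfl
  isLinearMap' t := ⟨fun x y => map_add _ x y, fun c x => map_smul _ c x⟩

theorem hasDerivAt_expFlow [CompleteSpace F] (L : F →L[ℝ] F) (x : F) (t : ℝ) :
    HasDerivAt (fun s => (expFlow L).toFun s x) (L ((expFlow L).toFun t x)) t := by
  have h := (hasDerivAt_exp_smul_const' (𝕂 := ℝ) L t).clm_apply (hasDerivAt_const t x)
  rw [map_zero, add_zero] at h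
  exact h

end Induced

/-! ### Autonomous linear differential equations -/

section Autonomous

variable {d : ℕ}

/-- The flow `φ(t, x) = exp(tA) x` of `ẋ = A x` on `ℝ^d` with the Euclidean norm. -/
def matrixFlow (A : Matrix (Fin d) (Fin d) ℝ) : LinearFlow (EuclideanSpace ℝ (Fin d)) :=
  expFlow (Matrix.toEuclideanCLM (𝕜 := ℝ) A)

/-- `matrixFlow A` solves `ẋ = A x`. -/
theorem hasDerivAt_matrixFlow (A : Matrix (Fin d) (Fin d) ℝ) (x : EuclideanSpace ℝ (Fin d))
    (t : ℝ) : HasDerivAt (fun s => (matrixFlow A).toFun s x)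
      (WithLp.toLp 2 (A.mulVec ((matrixFlow A).toFun t x).ofLp)) t :=
  hasDerivAt_expFlow (Matrix.toEuclideanCLM (𝕜 := ℝ) A) x t

/-- The real generalized eigenspace `E(μ)` of a real matrix for a complex number `μ`: the real
span of the real and imaginary parts of the complex generalized eigenvectors for `μ`. -/
def realGenEigenspace (A : Matrix (Fin d) (Fin d) ℝ) (μ : ℂ) :
    Submodule ℝ (EuclideanSpace ℝ (Fin d)) :=
  Submodule.span ℝ {x | ∃ w ∈ Module.End.maxGenEigenspace
    (Matrix.toLin' (A.map (fun r : ℝ => (r : ℂ)))) μ,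
      (∀ i, x i = (w i).re) ∨ (∀ i, x i = (w i).im)}

/-- The central subspace: the sum of the real generalized eigenspaces for the eigenvalues with
vanishing real part. -/
def centralSubspace (A : Matrix (Fin d) (Fin d) ℝ) : Submodule ℝ (EuclideanSpace ℝ (Fin d)) :=
  ⨆ μ ∈ {μ : ℂ | μ ∈ spectrum ℂ (A.map (fun r : ℝ => (r : ℂ))) ∧ μ.re = 0},
    realGenEigenspace A μ

/-- The projection of a subspace to projective space: the set of lines contained in it. -/
def projOfSubspace {F : Type*} [AddCommGroup F] [Module ℝ F] (V : Submodule ℝ F) : Set (ℙ ℝ F) :=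
  {p | p.submodule ≤ V}

end Autonomous

end

/-!
The theorem rests on two facts about the central subspace `V` of `exp(tA)`.

*Points of `V` are recurrent along arbitrarily small perturbations.* The minimal polynomial of a
vector `x ∈ V` with respect to `A` is, up to a factor `X`, a product of polynomials `X ^ 2 + c`
with `c ≥ 0`. Moving the numbers `c` a little makes them positive and pairwise distinct. A rank
one perturbation `B` of `A`, concentrated on the last vector of the basis `x, A x, …` of the
cyclic subspace of `x`, realizes this change (`aeval_perturbation_apply`); now `exp(tB) x` is
quasi-periodic, hence recurrent, while the points `exp(nTB) x` form a pseudo-orbit of `exp(tA)`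
(`isLinearlyChainRecurrent_of_aeval_eq_zero`). The orbit returns to the vector `x` and not only to
its direction, so the argument applies to the unit sphere and, with the last coordinate kept
fixed, to the upper hemisphere of the Poincaré sphere. A connected set of chain recurrent points
is chain transitive (`isChainTransitive_of_isPreconnected`). This covers the unit sphere of `V`
when `dim V ≥ 2` and the closure of `π_P K` for every cone `K` in `V`, since adding the apex makes
`K` star-shaped.

*Chains do not leave `V` and return.* The splittings of `ℂ^d` into the sums of generalized
eigenspaces with `Re μ > ±η` and `Re μ < ±η`, for small `η > 0`, are dominated: after a long time
the flow halves the width of every cone around the faster part, so a chain with small jumps stays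
in that cone (`LinearFlow.IsDominated.notMem_chainLimitSet`). Hence along chains a vector does not
lose an unstable component, and vectors of `V` do not gain a stable one, and no direction outside
`V` is joined to one in `V` by chains both ways
(`not_mutual_chainLimitSet_of_notMem_centralSubspace`). This gives maximality on projective space,
and on the sphere by projection.

The cones are then `V \ {0}` alone if the unit sphere of `V` is chain transitive. Otherwise `V` is
a line and the cones are its two open rays.
-/

open scoped LinearAlgebra.Projectivization

noncomputable section

/-! ### Chains as paths of a one-step relation -/

section Chains

variable {X : Type*} [MetricSpace X]

/-- The one-step relation whose transitive closure is the existence of an `(ε, T)`-chain. -/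
def ChainStep (Ψ : Flow ℝ X) (ε T : ℝ) (a b : X) : Prop :=
  ∃ t, T ≤ t ∧ dist (Ψ t a) b < ε

theorem existsChain_iff_transGen {Ψ : Flow ℝ X} {ε T : ℝ} {a b : X} :
    ExistsChain Ψ ε T a b ↔ Relation.TransGen (ChainStep Ψ ε T) a b := by
  constructor
  · rintro ⟨n, τ, x, hn, rfl, rfl, h⟩
    have key : ∀ m, m < n → Relation.TransGen (ChainStep Ψ ε T) (x 0) (x (m + 1)) := by
      intro m
      induction m with
      | zero => exact fun hm => .single ⟨τ 0, h 0 hm⟩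
      | succ m ih => exact fun hm => (ih (by omega)).tail ⟨τ (m + 1), h (m + 1) hm⟩
    obtain ⟨m, rfl⟩ := Nat.exists_eq_add_of_le' hn
    exact key m (by omega)
  · intro h
    induction h with
    | @single b h =>
      obtain ⟨t, ht, hd⟩ := h
      refine ⟨1, fun _ => t, fun i => if i = 0 then a else b, le_rfl, by simp, by simp, ?_⟩
      intro i hi
      obtain rfl : i = 0 := by omega
      simpa using ⟨ht, hd⟩
    | @tail b c _ h ih =>
      obtain ⟨t, ht, hd⟩ := h
      obtain ⟨n, τ, x, hn, h0, rfl, hx⟩ := ih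
      refine ⟨n + 1, Function.update τ n t, Function.update x (n + 1) c, by omega, ?_, by simp, ?_⟩
      · rw [Function.update_of_ne (by omega), h0]
      · intro i hi
        rcases Nat.lt_succ_iff_lt_or_eq.1 hi with hi | rfl
        · rw [Function.update_of_ne (by omega), Function.update_of_ne (by omega),
            Function.update_of_ne (by omega)]
          exact hx i hi
        · rw [Function.update_self, Function.update_of_ne (by omega), Function.update_self]
          exact ⟨ht, hd⟩

/-- Being joined by `(ε, T)`-chains in both directions is a locally constant property on a set of
chain recurrent points, because the jumps at the end and at the start of a chain are controlled by
strict inequalities. -/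
theorem isChainTransitive_of_isPreconnected {Ψ : Flow ℝ X} {M : Set X} (hM : IsPreconnected M)
    (h : ∀ a ∈ M, a ∈ chainLimitSet Ψ a) : IsChainTransitive Ψ M := by
  intro a ha b hb ε hε T hT
  rw [existsChain_iff_transGen]
  refine hM.induction₂' _ (fun x hx => ?_) (fun x y z _ _ _ => Relation.TransGen.trans) ha hb
  have hxx := existsChain_iff_transGen.1 (h x hx ε hε T hT)
  refine nhdsWithin_le_nhds (Filter.Eventually.and ?_ ?_)
  · obtain ⟨y, hy, t, ht, hd⟩ := Relation.TransGen.tail'_iff.1 hxx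
    have hc : Continuous fun z => dist (Ψ t y) z := continuous_const.dist continuous_id
    filter_upwards [hc.continuousAt.eventually_lt continuousAt_const hd] with z hz
    exact Relation.TransGen.tail'_iff.2 ⟨y, hy, t, ht, hz⟩
  · obtain ⟨y, ⟨t, ht, hd⟩, hy⟩ := Relation.TransGen.head'_iff.1 hxx
    have hc : Continuous fun z => dist (Ψ t z) y := (Ψ.continuous_toFun t).dist continuous_const
    filter_upwards [hc.continuousAt.eventually_lt continuousAt_const hd] with z hz
    exact Relation.TransGen.head'_iff.2 ⟨y, ⟨t, ht, hz⟩, hy⟩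

/-- A pseudo-orbit with constant time steps that returns near its starting point yields chain
recurrence, since the last point can be replaced by the starting point. -/
theorem mem_chainLimitSet_self_of_pseudoOrbit {Ψ : Flow ℝ X} {a : X}
    (h : ∀ ε > 0, ∀ T > 0, ∃ (n : ℕ) (u : ℕ → X), 1 ≤ n ∧ u 0 = a ∧ dist (u n) a < ε ∧
      ∀ i, dist (Ψ T (u i)) (u (i + 1)) < ε) : a ∈ chainLimitSet Ψ a := by
  intro ε hε T hT
  obtain ⟨n, u, hn, h0, hna, hu⟩ := h (ε / 2) (half_pos hε) T hT
  refine ⟨n, fun _ => T, Function.update u n a, hn, ?_, by simp, fun i hi => ⟨le_rfl, ?_⟩⟩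
  · rw [Function.update_of_ne (by omega), h0]
  · rw [Function.update_of_ne (by omega : i ≠ n)]
    by_cases hin : i + 1 = n
    · rw [hin, Function.update_self]
      have := hu i
      rw [hin] at this
      linarith [dist_triangle (Ψ T (u i)) (u n) a]
    · rw [Function.update_of_ne hin]
      linarith [hu i]

end Chains

/-! ### Pseudo-orbits of linear flows and of the induced flows -/

section Pseudo

variable {F : Type*} [NormedAddCommGroup F] [NormedSpace ℝ F]

theorem norm_inv_norm_smul_sub_le {a b : F} (ha : a ≠ 0) (hb : b ≠ 0) :
    ‖‖a‖⁻¹ • a - ‖b‖⁻¹ • b‖ ≤ 2 * (‖a - b‖ / ‖a‖) := by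
  have ha' := norm_pos_iff.2 ha
  have hb' := norm_pos_iff.2 hb
  have h : ‖a‖⁻¹ • a - ‖b‖⁻¹ • b = ‖a‖⁻¹ • (a - b) + (‖a‖⁻¹ * (‖b‖ - ‖a‖) * ‖b‖⁻¹) • b := by
    have : ‖a‖⁻¹ * (‖b‖ - ‖a‖) * ‖b‖⁻¹ = ‖a‖⁻¹ - ‖b‖⁻¹ := by field_simp
    rw [this]
    module
  rw [h]
  refine (norm_add_le _ _).trans ?_
  rw [norm_smul, norm_smul, norm_mul, norm_mul, norm_inv, norm_inv, norm_norm, norm_norm,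
    mul_assoc (‖a‖⁻¹ * _), inv_mul_cancel₀ hb'.ne', mul_one, two_mul, div_eq_inv_mul]
  gcongr
  rw [Real.norm_eq_abs, norm_sub_rev]
  exact abs_norm_sub_norm_le _ _

theorem sphereToProj_sphereFlow (φ : LinearFlow F) (t : ℝ) (v : Metric.sphere (0 : F) 1) :
    sphereToProj (φ.sphereFlow t v) = φ.projFlow t (sphereToProj v) :=
  (Projectivization.mk_eq_mk_iff' ℝ _ _ _ _).2 ⟨‖φ.toFun t v‖⁻¹, rfl⟩

theorem IsChainTransitive.image_sphereToProj {φ : LinearFlow F} {M : Set (Metric.sphere (0 : F) 1)}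
    (h : IsChainTransitive φ.sphereFlow M) :
    IsChainTransitive φ.projFlow (sphereToProj '' M) := by
  rintro _ ⟨a, ha, rfl⟩ _ ⟨b, hb, rfl⟩ ε hε T hT
  rw [existsChain_iff_transGen]
  refine (existsChain_iff_transGen.1 (h a ha b hb ε hε T hT)).lift sphereToProj ?_
  rintro v w ⟨t, ht, hd⟩
  refine ⟨t, ht, ?_⟩
  rw [← sphereToProj_sphereFlow, dist_sphereToProj]
  rw [Subtype.dist_eq, dist_eq_norm] at hd
  exact (min_le_left _ _).trans_lt hd

/-- A vector is linearly chain recurrent if it is recurrent along arbitrarily accurate linear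
pseudo-orbits, the jumps being measured relative to the size of the points. In contrast to chain
recurrence of the direction of `x`, the pseudo-orbits return near the vector `x` itself. -/
def LinearFlow.IsLinearlyChainRecurrent (φ : LinearFlow F) (x : F) : Prop :=
  ∀ δ > 0, ∀ T > 0, ∃ (n : ℕ) (y : ℕ → F), 1 ≤ n ∧ y 0 = x ∧ ‖y n - x‖ ≤ δ ∧
    ∀ i, ‖φ.toFun T (y i) - y (i + 1)‖ ≤ δ * ‖φ.toFun T (y i)‖

/-- Normalizing a linear pseudo-orbit gives a pseudo-orbit on the unit sphere. -/
theorem LinearFlow.exists_sphere_pseudoOrbit (φ : LinearFlow F) {δ T : ℝ} (hδ : δ < 1) {n : ℕ}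
    {y : ℕ → F} {z : Metric.sphere (0 : F) 1} (h0 : y 0 = z) (hn : ‖y n - z‖ ≤ δ)
    (hy : ∀ i, ‖φ.toFun T (y i) - y (i + 1)‖ ≤ δ * ‖φ.toFun T (y i)‖) :
    ∃ u : ℕ → Metric.sphere (0 : F) 1, (∀ i, (u i : F) = ‖y i‖⁻¹ • y i) ∧ u 0 = z ∧
      dist (u n) z ≤ 2 * δ ∧ ∀ i, dist (φ.sphereFlow T (u i)) (u (i + 1)) ≤ 2 * δ := by
  have hz : (z : F) ≠ 0 := ne_zero_of_mem_unit_sphere z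
  have hz1 : ‖(z : F)‖ = 1 := norm_eq_of_mem_sphere z
  have hne : ∀ i, y i ≠ 0 := by
    intro i
    induction i with
    | zero => rwa [h0]
    | succ i ih =>
      intro h
      have h1 := hy i
      rw [h, sub_zero] at h1
      have h2 := norm_pos_iff.2 (φ.apply_ne_zero T ih)
      nlinarith
  let u : ℕ → Metric.sphere (0 : F) 1 := fun i => ⟨‖y i‖⁻¹ • y i, by
    rw [mem_sphere_zero_iff_norm, norm_smul, norm_inv, norm_norm,
      inv_mul_cancel₀ (norm_ne_zero_iff.2 (hne i))]⟩
  refine ⟨u, fun i => rfl, Subtype.ext ?_, ?_, fun i => ?_⟩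
  · change ‖y 0‖⁻¹ • y 0 = z
    rw [h0, hz1, inv_one, one_smul]
  · rw [dist_comm, Subtype.dist_eq, dist_eq_norm]
    have h := norm_inv_norm_smul_sub_le hz (hne n)
    rw [hz1, inv_one, one_smul, div_one, norm_sub_rev (z : F) (y n)] at h
    exact h.trans (by linarith)
  · have hφ : ((φ.sphereFlow T (u i) : Metric.sphere (0 : F) 1) : F) =
        ‖φ.toFun T (y i)‖⁻¹ • φ.toFun T (y i) := by
      change ‖φ.toFun T (‖y i‖⁻¹ • y i)‖⁻¹ • φ.toFun T (‖y i‖⁻¹ • y i) = _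
      rw [(φ.isLinearMap' T).map_smul, norm_smul, norm_inv, norm_norm, mul_inv, inv_inv, smul_smul]
      congr 1
      field_simp [norm_ne_zero_iff.2 (hne i)]
    rw [Subtype.dist_eq, dist_eq_norm, hφ]
    have h2 := norm_pos_iff.2 (φ.apply_ne_zero T (hne i))
    refine (norm_inv_norm_smul_sub_le (φ.apply_ne_zero T (hne i)) (hne (i + 1))).trans ?_
    gcongr
    rw [div_le_iff₀ h2]
    exact hy i

theorem LinearFlow.IsLinearlyChainRecurrent.mem_chainLimitSet_sphereFlow {φ : LinearFlow F}
    {z : Metric.sphere (0 : F) 1} (h : φ.IsLinearlyChainRecurrent z) :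
    z ∈ chainLimitSet φ.sphereFlow z := by
  refine mem_chainLimitSet_self_of_pseudoOrbit fun ε hε T hT => ?_
  obtain ⟨δ, hδ, hδ'⟩ := exists_between (lt_min one_pos (div_pos hε two_pos))
  rw [lt_min_iff] at hδ'
  obtain ⟨n, y, hn, h0, hyn, hy⟩ := h δ hδ T hT
  obtain ⟨u, -, hu0, hun, hu⟩ := φ.exists_sphere_pseudoOrbit hδ'.1 h0 hyn hy
  exact ⟨n, u, hn, hu0, by linarith, fun i => by linarith [hu i]⟩

/-- On the Poincaré sphere the pseudo-orbits of the first component are carried along with constant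
second component, so they stay in the upper hemisphere. -/
theorem LinearFlow.IsLinearlyChainRecurrent.mem_chainLimitSet_hemisphereFlow {φ : LinearFlow F}
    {z : closedUpperHemisphere F}
    (h : φ.IsLinearlyChainRecurrent (z : WithLp 2 (F × ℝ)).fst) :
    z ∈ chainLimitSet φ.hemisphereFlow z := by
  refine mem_chainLimitSet_self_of_pseudoOrbit fun ε hε T hT => ?_
  obtain ⟨δ, hδ, hδ'⟩ := exists_between (lt_min one_pos (div_pos hε two_pos))
  rw [lt_min_iff] at hδ'
  obtain ⟨n, y, hn, h0, hyn, hy⟩ := h δ hδ T hT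
  set r : ℝ := (z : WithLp 2 (F × ℝ)).snd with hr
  have hdiff : ∀ v w : F, ‖WithLp.toLp 2 (v, r) - WithLp.toLp 2 (w, r)‖ = ‖v - w‖ := by
    intro v w
    rw [← WithLp.toLp_sub, Prod.mk_sub_mk, sub_self, WithLp.norm_toLp_fst]
  have hle : ∀ v : F, ‖v‖ ≤ ‖WithLp.toLp 2 (v, r)‖ := fun v =>
    WithLp.norm_fst_le F (WithLp.toLp 2 (v, r))
  obtain ⟨u, hu', hu0, hun, hu⟩ := φ.extend.exists_sphere_pseudoOrbit (T := T) (n := n)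
    (y := fun i => WithLp.toLp 2 (y i, r)) (z := z.1) hδ'.1
    (by rw [h0]; rfl)
    (by
      have := hdiff (y n) (z : WithLp 2 (F × ℝ)).fst
      exact this.trans_le hyn)
    (fun i => (hdiff _ _).trans_le
      ((hy i).trans (mul_le_mul_of_nonneg_left (hle (φ.toFun T (y i))) hδ.le)))
  have hmem : ∀ i, u i ∈ closedUpperHemisphere F := by
    intro i
    change 0 ≤ (u i : WithLp 2 (F × ℝ)).snd
    rw [hu' i]
    exact mul_nonneg (inv_nonneg.2 (norm_nonneg _)) z.2
  refine ⟨n, fun i => ⟨u i, hmem i⟩, hn, Subtype.ext hu0, ?_, fun i => ?_⟩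
  · rw [Subtype.dist_eq]
    exact hun.trans_lt (by linarith)
  · rw [Subtype.dist_eq]
    exact (hu i).trans_lt (by linarith)

end Pseudo

/-! ### Products of the polynomials `X ^ 2 + c` with `c ≥ 0` -/

section Polynomials

open Polynomial

theorem Polynomial.Monic.dvd_or_exists_of_dvd_irreducible_mul {f p q : ℝ[X]} (hp : p.Monic)
    (hf : Irreducible f) (hfm : f.Monic) (h : p ∣ f * q) :
    p ∣ q ∨ ∃ r : ℝ[X], r.Monic ∧ p = f * r ∧ r ∣ q := by
  rcases hf.isCoprime_or_dvd p with hc | ⟨r, rfl⟩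
  · exact Or.inl (hc.symm.dvd_of_dvd_mul_left h)
  · exact Or.inr ⟨r, hfm.of_mul_monic_left hp, rfl, (mul_dvd_mul_iff_left hf.ne_zero).1 h⟩

theorem irreducible_X_sq_add_C {c : ℝ} (hc : 0 < c) : Irreducible (X ^ 2 + C c : ℝ[X]) := by
  refine irreducible_of_degree_le_three_of_not_isRoot ?_ ?_
  · rw [natDegree_X_pow_add_C]
    decide
  · intro x hx
    simp only [IsRoot, eval_add, eval_pow, eval_X, eval_C] at hx
    nlinarith [sq_nonneg x]

/-- The monic divisors of a product of polynomials `X ^ 2 + c` with `c ≥ 0` have the same form, up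
to a power of `X`. -/
theorem exists_eq_X_pow_mul_prod_of_dvd {s : Multiset ℝ} (hs : ∀ c ∈ s, 0 ≤ c) {p : ℝ[X]}
    (hp : p.Monic) (h : p ∣ (s.map fun c => X ^ 2 + C c).prod) :
    ∃ (a : ℕ) (t : Multiset ℝ), (∀ c ∈ t, 0 ≤ c) ∧
      p = X ^ a * (t.map fun c => X ^ 2 + C c).prod := by
  induction s using Multiset.induction_on generalizing p with
  | empty =>
    refine ⟨0, 0, by simp, ?_⟩
    simpa using hp.eq_one_of_isUnit (isUnit_of_dvd_one (by simpa using h))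
  | cons c s ih =>
    have hs' : ∀ c ∈ s, 0 ≤ c := fun b hb => hs b (Multiset.mem_cons_of_mem hb)
    rw [Multiset.map_cons, Multiset.prod_cons] at h
    rcases (hs c (Multiset.mem_cons_self c s)).eq_or_lt with rfl | hc
    · have hX : ∀ {q : ℝ[X]}, q.Monic → q ∣ (s.map fun c => X ^ 2 + C c).prod →
          ∃ (a : ℕ) (t : Multiset ℝ), (∀ c ∈ t, 0 ≤ c) ∧
            X * q = X ^ a * (t.map fun c => X ^ 2 + C c).prod := by
        intro q hq hqs
        obtain ⟨a, t, ht, rfl⟩ := ih hs' hq hqs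
        exact ⟨a + 1, t, ht, by ring⟩
      rw [show (X ^ 2 + C 0 : ℝ[X]) = X * X by rw [C_0, add_zero, sq], mul_assoc] at h
      rcases hp.dvd_or_exists_of_dvd_irreducible_mul irreducible_X monic_X h with
        h₁ | ⟨q, hq, rfl, h₁⟩
      · rcases hp.dvd_or_exists_of_dvd_irreducible_mul irreducible_X monic_X h₁ with
          h₂ | ⟨q, hq, rfl, h₂⟩
        · exact ih hs' hp h₂
        · exact hX hq h₂
      · rcases hq.dvd_or_exists_of_dvd_irreducible_mul irreducible_X monic_X h₁ with
          h₂ | ⟨r, hr, rfl, h₂⟩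
        · exact hX hq h₂
        · obtain ⟨a, t, ht, rfl⟩ := ih hs' hr h₂
          exact ⟨a + 2, t, ht, by ring⟩
    · rcases hp.dvd_or_exists_of_dvd_irreducible_mul (irreducible_X_sq_add_C hc)
        (monic_X_pow_add_C c two_ne_zero) h with h₁ | ⟨q, hq, rfl, h₁⟩
      · exact ih hs' hp h₁
      · obtain ⟨a, t, ht, rfl⟩ := ih hs' hq h₁
        refine ⟨a, c ::ₘ t, ?_, ?_⟩
        · intro b hb
          rcases Multiset.mem_cons.1 hb with rfl | hb
          · exact hc.le
          · exact ht b hb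
        · rw [Multiset.map_cons, Multiset.prod_cons]
          ring

/-- The polynomial `X ^ a * ∏ i, (X ^ 2 + c i)`. -/
def oscillatorPoly {m : ℕ} (a : ℕ) (c : Fin m → ℝ) : ℝ[X] :=
  X ^ a * ∏ i, (X ^ 2 + C (c i))

/-- Since `X ^ 2 = X ^ 2 + 0`, the power of `X` can be reduced to an exponent at most one. -/
theorem exists_eq_oscillatorPoly_of_dvd {s : Multiset ℝ} (hs : ∀ c ∈ s, 0 ≤ c) {p : ℝ[X]}
    (hp : p.Monic) (h : p ∣ (s.map fun c => X ^ 2 + C c).prod) :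
    ∃ (m a : ℕ) (c : Fin m → ℝ), a ≤ 1 ∧ (∀ i, 0 ≤ c i) ∧ p = oscillatorPoly a c := by
  obtain ⟨b, t, ht, rfl⟩ := exists_eq_X_pow_mul_prod_of_dvd hs hp h
  obtain ⟨l, hl⟩ : ∃ l : List ℝ, (l : Multiset ℝ) = Multiset.replicate (b / 2) 0 + t :=
    ⟨_, Multiset.coe_toList _⟩
  refine ⟨l.length, b % 2, l.get, by omega, fun i => ?_, ?_⟩
  · have hi : l.get i ∈ (l : Multiset ℝ) := List.get_mem l i
    rw [hl, Multiset.mem_add] at hi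
    rcases hi with hi | hi
    · exact (Multiset.eq_of_mem_replicate hi).ge
    · exact ht _ hi
  · have h1 : ∏ i, (X ^ 2 + C (l.get i) : ℝ[X]) =
        ((l : Multiset ℝ).map fun c => (X ^ 2 + C c : ℝ[X])).prod := by
      rw [Multiset.map_coe, Multiset.prod_coe, ← List.prod_ofFn]
      congr 1
      conv_rhs => rw [← List.ofFn_get l]
      rw [List.map_ofFn]
      rfl
    rw [oscillatorPoly, h1, hl, Multiset.map_add, Multiset.prod_add, Multiset.map_replicate,
      Multiset.prod_replicate, C_0, add_zero, ← pow_mul, ← mul_assoc, ← pow_add, Nat.mod_add_div]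

theorem monic_oscillatorPoly {m : ℕ} (a : ℕ) (c : Fin m → ℝ) : (oscillatorPoly a c).Monic :=
  (monic_X_pow a).mul (monic_prod_of_monic _ _ fun i _ => monic_X_pow_add_C (c i) two_ne_zero)

theorem natDegree_oscillatorPoly {m : ℕ} (a : ℕ) (c : Fin m → ℝ) :
    (oscillatorPoly a c).natDegree = a + 2 * m := by
  rw [oscillatorPoly, (monic_X_pow a).natDegree_mul
    (monic_prod_of_monic _ _ fun i _ => monic_X_pow_add_C (c i) two_ne_zero), natDegree_X_pow,
    natDegree_prod_of_monic _ _ fun i _ => monic_X_pow_add_C (c i) two_ne_zero]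
  simp only [natDegree_X_pow_add_C, Finset.sum_const, Finset.card_univ, Fintype.card_fin,
    smul_eq_mul, mul_comm]

theorem isCoprime_X_sq_add_C {b c : ℝ} (h : b ≠ c) :
    IsCoprime (X ^ 2 + C b : ℝ[X]) (X ^ 2 + C c) := by
  refine ⟨C (b - c)⁻¹, -C (b - c)⁻¹, ?_⟩
  have h1 : (b - c)⁻¹ * (b - c) = 1 := inv_mul_cancel₀ (sub_ne_zero.2 h)
  calc C (b - c)⁻¹ * (X ^ 2 + C b) + -C (b - c)⁻¹ * (X ^ 2 + C c)
      = C (b - c)⁻¹ * (C b - C c) := by ring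
    _ = 1 := by rw [← C_sub, ← C_mul, h1, C_1]

theorem isCoprime_X_X_sq_add_C {c : ℝ} (h : c ≠ 0) : IsCoprime (X : ℝ[X]) (X ^ 2 + C c) := by
  refine ⟨-C c⁻¹ * X, C c⁻¹, ?_⟩
  calc -C c⁻¹ * X * X + C c⁻¹ * (X ^ 2 + C c) = C c⁻¹ * C c := by ring
    _ = 1 := by rw [← C_mul, inv_mul_cancel₀ h, C_1]

end Polynomials

/-! ### Recurrence of quasi-periodic orbits -/

section QuasiPeriodic

open Polynomial

variable {F : Type*} [NormedAddCommGroup F] [NormedSpace ℝ F]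

/-- The orbit `t ↦ exp(tB) x` is a trigonometric polynomial with real frequencies. -/
def IsQuasiPeriodic (B : F →L[ℝ] F) (x : F) : Prop :=
  ∃ (ι : Type) (_ : Fintype ι) (ω : ι → ℝ) (a b : ι → F), ∀ t : ℝ,
    NormedSpace.exp (t • B) x = ∑ i, (Real.cos (ω i * t) • a i + Real.sin (ω i * t) • b i)

theorem IsQuasiPeriodic.add {B : F →L[ℝ] F} {x y : F} (hx : IsQuasiPeriodic B x)
    (hy : IsQuasiPeriodic B y) : IsQuasiPeriodic B (x + y) := by
  obtain ⟨ι, _, ω, a, b, h⟩ := hx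
  obtain ⟨κ, _, ω', a', b', h'⟩ := hy
  refine ⟨ι ⊕ κ, inferInstance, Sum.elim ω ω', Sum.elim a a', Sum.elim b b', fun t => ?_⟩
  rw [map_add, h, h', Fintype.sum_sum_type]
  rfl

theorem isQuasiPeriodic_zero (B : F →L[ℝ] F) : IsQuasiPeriodic B 0 :=
  ⟨Empty, inferInstance, fun _ => 0, fun _ => 0, fun _ => 0, fun t => by simp⟩

theorem exists_add_of_isCoprime {B : F →L[ℝ] F} {p q : ℝ[X]} (hpq : IsCoprime p q) {x : F}
    (hx : aeval B (p * q) x = 0) :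
    ∃ y z, aeval B p y = 0 ∧ aeval B q z = 0 ∧ x = y + z := by
  obtain ⟨u, v, huv⟩ := hpq
  refine ⟨aeval B (v * q) x, aeval B (u * p) x, ?_, ?_, ?_⟩
  · rw [← mul_apply_eq_comp, ← map_mul, show p * (v * q) = v * (p * q) by ring, map_mul,
      mul_apply_eq_comp, hx, map_zero]
  · rw [← mul_apply_eq_comp, ← map_mul, show q * (u * p) = u * (p * q) by ring, map_mul,
      mul_apply_eq_comp, hx, map_zero]
  · rw [← add_apply, ← map_add, add_comm, huv, map_one,
      one_apply_eq_self]

/-- The values of a quasi-periodic orbit at the multiples of `T` are a continuous function of the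
powers of one element of a torus, and these return to the identity. -/
theorem IsQuasiPeriodic.exists_norm_sub_le {B : F →L[ℝ] F} {x : F} (h : IsQuasiPeriodic B x)
    (T : ℝ) {δ : ℝ} (hδ : 0 < δ) :
    ∃ n : ℕ, 1 ≤ n ∧ ‖NormedSpace.exp ((n * T : ℝ) • B) x - x‖ ≤ δ := by
  obtain ⟨ι, _, ω, a, b, h⟩ := h
  let g : ι → Circle := fun i => Circle.exp (ω i * T)
  let Θ : (ι → Circle) → F := fun z => ∑ i, ((z i : ℂ).re • a i + (z i : ℂ).im • b i)
  have hΘ : Continuous Θ := by fun_prop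
  have hg : ∀ n : ℕ, Θ (g ^ n) = NormedSpace.exp ((n * T : ℝ) • B) x := by
    intro n
    rw [h]
    refine Finset.sum_congr rfl fun i _ => ?_
    have h1 : (((g ^ n) i : Circle) : ℂ) = Complex.exp (((ω i * (n * T) : ℝ) : ℂ) * Complex.I) := by
      rw [Pi.pow_apply, Circle.coe_pow, Circle.coe_exp, ← Complex.exp_nat_mul]
      push_cast
      ring_nf
    rw [h1, Complex.exp_ofReal_mul_I_re, Complex.exp_ofReal_mul_I_im]
  have h1 : Θ 1 = x := by
    have := hg 0
    rw [pow_zero] at this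
    rw [this]
    simp
  have hcl := (mapClusterPt_one_atTop_pow g).continuousAt_comp hΘ.continuousAt
  rw [h1] at hcl
  obtain ⟨n, hn, hd⟩ := ((hcl.frequently (Metric.ball_mem_nhds x hδ)).and_eventually
    (Filter.eventually_ge_atTop 1)).exists
  refine ⟨n, hd, ?_⟩
  rw [← hg]
  exact (dist_eq_norm (Θ (g ^ n)) x).symm.trans_le (le_of_lt hn)

variable [CompleteSpace F]

theorem exp_smul_apply_add (B : F →L[ℝ] F) (s t : ℝ) (x : F) :
    NormedSpace.exp ((s + t) • B) x = NormedSpace.exp (s • B) (NormedSpace.exp (t • B) x) :=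
  (expFlow B).map_add' s t x

theorem exp_zero_smul_apply (B : F →L[ℝ] F) (x : F) : NormedSpace.exp ((0 : ℝ) • B) x = x :=
  (expFlow B).map_zero' x

theorem isQuasiPeriodic_of_apply_eq_zero {B : F →L[ℝ] F} {x : F} (hx : B x = 0) :
    IsQuasiPeriodic B x := by
  refine ⟨Unit, inferInstance, fun _ => 0, fun _ => x, fun _ => 0, fun t => ?_⟩
  have hd : ∀ t, HasDerivAt (fun s : ℝ => NormedSpace.exp (s • B) x) 0 t := by
    intro t
    have h := (hasDerivAt_exp_smul_const (𝕂 := ℝ) B t).clm_apply (hasDerivAt_const t x)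
    rwa [map_zero, add_zero, mul_apply_eq_comp, hx, map_zero] at h
  have h := is_const_of_deriv_eq_zero (fun t => (hd t).differentiableAt) (fun t => (hd t).deriv) t 0
  simpa [exp_zero_smul_apply] using h

/-- A solution of `ÿ = -ω² y` is a harmonic oscillation. -/
theorem isQuasiPeriodic_of_apply_apply_eq {B : F →L[ℝ] F} {x : F} {ω : ℝ} (hω : ω ≠ 0)
    (hx : B (B x) = -(ω ^ 2) • x) : IsQuasiPeriodic B x := by
  refine ⟨Unit, inferInstance, fun _ => ω, fun _ => x, fun _ => ω⁻¹ • B x, fun t => ?_⟩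
  set f : ℝ → F := fun t => Real.cos (ω * t) • x + Real.sin (ω * t) • ω⁻¹ • B x with hf
  have hd : ∀ t, HasDerivAt (fun s : ℝ => NormedSpace.exp (s • (-B)) (f s)) 0 t := by
    intro t
    have hl : HasDerivAt (fun s : ℝ => ω * s) ω t := by
      simpa using (hasDerivAt_id t).const_mul ω
    have h1 : HasDerivAt f ((-Real.sin (ω * t) * ω) • x + (Real.cos (ω * t) * ω) • ω⁻¹ • B x) t :=
      (hl.cos.smul_const x).add (hl.sin.smul_const _)
    have h := (hasDerivAt_exp_smul_const (𝕂 := ℝ) (-B) t).clm_apply h1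
    rw [mul_apply_eq_comp, ← map_add] at h
    convert h using 1
    rw [← map_zero (NormedSpace.exp (t • -B))]
    congr 1
    simp only [hf, neg_apply, map_add, map_smul, hx, smul_smul]
    match_scalars <;> field_simp <;> ring
  have h := is_const_of_deriv_eq_zero (fun t => (hd t).differentiableAt) (fun t => (hd t).deriv) t 0
  have h0 : f 0 = x := by simp [hf]
  rw [h0, exp_zero_smul_apply] at h
  have h2 := exp_smul_apply_add B t (-t) (f t)
  rw [add_neg_cancel, exp_zero_smul_apply, neg_smul, ← smul_neg, h] at h2
  simpa [hf] using h2.symm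

theorem isQuasiPeriodic_of_aeval_prod {B : F →L[ℝ] F} {m : ℕ} {c : Fin m → ℝ} (hc : ∀ i, 0 < c i)
    (hinj : Function.Injective c) (s : Finset (Fin m)) {x : F}
    (hx : aeval B (∏ i ∈ s, (X ^ 2 + C (c i))) x = 0) : IsQuasiPeriodic B x := by
  induction s using Finset.induction_on generalizing x with
  | empty =>
    have : x = 0 := by simpa using hx
    exact this ▸ isQuasiPeriodic_zero B
  | insert i s hi ih =>
    rw [Finset.prod_insert hi] at hx
    obtain ⟨y, z, hy, hz, rfl⟩ := exists_add_of_isCoprime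
      (IsCoprime.prod_right fun j hj => isCoprime_X_sq_add_C
        (hinj.ne (ne_of_mem_of_not_mem hj hi).symm)) hx
    refine IsQuasiPeriodic.add ?_ (ih hz)
    refine isQuasiPeriodic_of_apply_apply_eq (Real.sqrt_pos.2 (hc i)).ne' ?_
    rw [Real.sq_sqrt (hc i).le]
    rw [map_add, map_pow, aeval_X, aeval_C, Algebra.algebraMap_eq_smul_one, pow_two] at hy
    rw [neg_smul]
    exact eq_neg_of_add_eq_zero_left hy

/-- A squarefree product of `X` and polynomials `X ^ 2 + c` with `c > 0` annihilates only vectors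
with quasi-periodic orbits. -/
theorem isQuasiPeriodic_of_aeval_oscillatorPoly {B : F →L[ℝ] F} {m a : ℕ} {c : Fin m → ℝ}
    (ha : a ≤ 1) (hc : ∀ i, 0 < c i) (hinj : Function.Injective c) {x : F}
    (hx : aeval B (oscillatorPoly a c) x = 0) : IsQuasiPeriodic B x := by
  rw [oscillatorPoly] at hx
  interval_cases a
  · rw [pow_zero, one_mul] at hx
    exact isQuasiPeriodic_of_aeval_prod hc hinj _ hx
  · rw [pow_one] at hx
    obtain ⟨y, z, hy, hz, rfl⟩ := exists_add_of_isCoprime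
      (IsCoprime.prod_right fun j _ => isCoprime_X_X_sq_add_C (hc j).ne') hx
    rw [aeval_X] at hy
    exact (isQuasiPeriodic_of_apply_eq_zero hy).add (isQuasiPeriodic_of_aeval_prod hc hinj _ hz)

end QuasiPeriodic

/-! ### Rank one perturbations and linear chain recurrence -/

section Perturbation

open Polynomial

variable {F : Type*} [NormedAddCommGroup F] [NormedSpace ℝ F]

theorem exists_monic_forall_aeval_eq_zero_iff {A : F →L[ℝ] F} {x : F} {p : ℝ[X]} (hp : p ≠ 0)
    (hpx : aeval A p x = 0) :
    ∃ μ : ℝ[X], μ.Monic ∧ ∀ r : ℝ[X], aeval A r x = 0 ↔ μ ∣ r := by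
  let I : Ideal ℝ[X] :=
    { carrier := {r | aeval A r x = 0}
      add_mem' := fun {a b} ha hb => by
        change aeval A (a + b) x = 0
        rw [map_add, add_apply, show aeval A a x = 0 from ha, show aeval A b x = 0 from hb,
          add_zero]
      zero_mem' := by simp
      smul_mem' := fun r a ha => by
        change aeval A (r * a) x = 0
        rw [map_mul, mul_apply_eq_comp, show aeval A a x = 0 from ha, map_zero] }
  have hg : ∀ r : ℝ[X], aeval A r x = 0 ↔ Submodule.IsPrincipal.generator I ∣ r := fun r =>
    Submodule.IsPrincipal.mem_iff_generator_dvd I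
  have hg0 : Submodule.IsPrincipal.generator I ≠ 0 := by
    intro h0
    have := (hg p).1 hpx
    rw [h0, zero_dvd_iff] at this
    exact hp this
  exact ⟨normalize (Submodule.IsPrincipal.generator I), monic_normalize hg0, fun r => by
    rw [hg, normalize_dvd_iff]⟩

/-- If `μ` is the minimal polynomial of `x`, the coordinate of `A ^ (deg μ - 1) x` with respect to
the basis `x, A x, …` of the cyclic subspace of `x` is a linear functional. -/
theorem exists_dual_aeval_apply [FiniteDimensional ℝ F] {A : F →L[ℝ] F} {x : F} {μ : ℝ[X]} {k : ℕ}
    (hk : μ.natDegree = k + 1) (hμ : ∀ r : ℝ[X], aeval A r x = 0 ↔ μ ∣ r) :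
    ∃ ℓ : F →L[ℝ] ℝ, ∀ r : ℝ[X], r.natDegree ≤ k → ℓ (aeval A r x) = r.coeff k := by
  let ev : ℝ[X] →ₗ[ℝ] F :=
    (LinearMap.applyₗ x ∘ₗ ContinuousLinearMap.coeLM ℝ) ∘ₗ (aeval A).toLinearMap
  have hev : ∀ r, ev r = aeval A r x := fun r => rfl
  have hnot : ev (X ^ k) ∉ (degreeLT ℝ k).map ev := by
    rintro ⟨r, hr, hrx⟩
    have hr' : r.degree < (k : ℕ) := mem_degreeLT.1 hr
    have h0 : aeval A (X ^ k - r) x = 0 := by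
      rw [← hev, map_sub, hrx, sub_self]
    have hm : (X ^ k - r).Monic := monic_X_pow_sub hr'
    have h1 := natDegree_le_of_dvd ((hμ _).1 h0) hm.ne_zero
    have h2 : (X ^ k - r).natDegree ≤ k := (natDegree_sub_le_of_le (natDegree_X_pow_le k)
      (natDegree_le_of_degree_le hr'.le)).trans (max_self k).le
    omega
  obtain ⟨f, hf0, hf1⟩ := LinearMap.exists_extend_of_notMem (0 : _ →ₗ[ℝ] ℝ) hnot 1
  refine ⟨LinearMap.toContinuousLinearMap f, fun r hr => ?_⟩
  have hlt : ∀ s : ℝ[X], s.degree < (k : ℕ) → f (ev s) = 0 := fun s hs =>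
    congr($hf0 ⟨ev s, s, mem_degreeLT.2 hs, rfl⟩)
  have hdec : r = C (r.coeff k) * X ^ k + (r - C (r.coeff k) * X ^ k) := by ring
  have hdeg : (r - C (r.coeff k) * X ^ k).degree < ((k : ℕ) : WithBot ℕ) := by
    rw [degree_lt_iff_coeff_zero]
    intro m hm
    rw [coeff_sub, coeff_C_mul, coeff_X_pow]
    rcases hm.eq_or_lt with rfl | hm
    · simp
    · rw [if_neg hm.ne', coeff_eq_zero_of_natDegree_lt (hr.trans_lt hm), mul_zero, sub_zero]
  change f (ev r) = r.coeff k
  conv_lhs => rw [hdec]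
  rw [map_add, map_add, hlt _ hdeg, ← smul_eq_C_mul, map_smul, map_smul, hf1]
  simp

/-- Changing `A` on the last vector of the basis `x, A x, …` of the cyclic subspace of `x` replaces
the minimal polynomial of `x` by an arbitrary monic polynomial `q` of the same degree. -/
theorem aeval_perturbation_apply {A : F →L[ℝ] F} {x : F} {k : ℕ} {ℓ : F →L[ℝ] ℝ}
    (hℓ : ∀ r : ℝ[X], r.natDegree ≤ k → ℓ (aeval A r x) = r.coeff k) {q : ℝ[X]} (hq : q.Monic)
    (hqk : q.natDegree = k + 1) :
    aeval (A - ℓ.smulRight (aeval A q x)) q x = 0 := by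
  set B := A - ℓ.smulRight (aeval A q x) with hB
  have hBv : ∀ v, B v = A v - ℓ v • aeval A q x := fun v => rfl
  have hpow : ∀ j ≤ k, (B ^ j) x = (A ^ j) x := by
    intro j
    induction j with
    | zero => simp
    | succ j ih =>
      intro hj
      have h := hℓ (X ^ j) ((natDegree_X_pow_le j).trans (by omega))
      rw [map_pow, aeval_X, coeff_X_pow, if_neg (by omega)] at h
      rw [pow_succ', pow_succ', mul_apply_eq_comp, mul_apply_eq_comp, ih (by omega), hBv, h,
        zero_smul, sub_zero]
  have hr : ∀ r : ℝ[X], r.natDegree ≤ k → aeval B r x = aeval A r x := by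
    intro r hr
    rw [aeval_eq_sum_range' (Nat.lt_succ_of_le hr), aeval_eq_sum_range' (Nat.lt_succ_of_le hr),
      sum_apply, sum_apply]
    refine Finset.sum_congr rfl fun j hj => ?_
    rw [smul_apply, smul_apply, hpow j (by simpa [Nat.lt_succ_iff] using hj)]
  have hdeg : q.divX.natDegree ≤ k := by
    rw [natDegree_divX_eq_natDegree_tsub_one, hqk]
    rfl
  have hlead : q.divX.coeff k = 1 := by
    rw [coeff_divX, ← hqk]
    exact hq.coeff_natDegree
  have hsplit : ∀ D : F →L[ℝ] F, aeval D q x = D (aeval D q.divX x) + q.coeff 0 • x := by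
    intro D
    conv_lhs => rw [← X_mul_divX_add q]
    rw [map_add, map_mul, aeval_X, aeval_C, Algebra.algebraMap_eq_smul_one, add_apply,
      mul_apply_eq_comp, smul_apply, one_apply_eq_self]
  rw [hsplit B, hr _ hdeg, hBv, hℓ _ hdeg, hlead, one_smul, hsplit A]
  abel

theorem continuous_aeval_oscillatorPoly (A : F →L[ℝ] F) {m : ℕ} (a : ℕ) {c : ℝ → Fin m → ℝ}
    (hc : ∀ i, Continuous fun η => c η i) :
    Continuous fun η => aeval A (oscillatorPoly a (c η)) := by
  have h : ∀ s : Finset (Fin m),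
      Continuous fun η => aeval A (∏ i ∈ s, (X ^ 2 + C (c η i) : ℝ[X])) := by
    intro s
    induction s using Finset.induction_on with
    | empty => simpa using continuous_const
    | insert i s hi ih =>
      simp only [Finset.prod_insert hi, map_mul, map_add, aeval_C, map_pow, aeval_X,
        Algebra.algebraMap_eq_smul_one]
      exact (continuous_const.add ((hc i).smul continuous_const)).mul ih
  simp only [oscillatorPoly, map_mul]
  exact continuous_const.mul (h _)

theorem continuous_exp_clm [CompleteSpace F] :
    Continuous (NormedSpace.exp : (F →L[ℝ] F) → (F →L[ℝ] F)) := by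
  let _ : NormedAlgebra ℚ (F →L[ℝ] F) := NormedAlgebra.restrictScalars ℚ ℝ _
  exact NormedSpace.exp_continuous

/-- Shifting the numbers `c i` by `η (i + 1)` makes them pairwise distinct for small `η > 0`. -/
theorem eventually_injective_add_mul {m : ℕ} (c : Fin m → ℝ) :
    ∀ᶠ η : ℝ in nhdsWithin 0 (Set.Ioi 0),
      Function.Injective fun i : Fin m => c i + η * ((i : ℝ) + 1) := by
  have h : ∀ i j : Fin m, i ≠ j → ∀ᶠ η : ℝ in nhdsWithin 0 (Set.Ioi 0),
      c i + η * ((i : ℝ) + 1) ≠ c j + η * ((j : ℝ) + 1) := by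
    intro i j hij
    have hij' : (i : ℝ) - j ≠ 0 := by
      rw [sub_ne_zero]
      exact_mod_cast Fin.val_ne_of_ne hij
    by_cases hc : c i = c j
    · filter_upwards [self_mem_nhdsWithin] with η hη h
      rw [hc] at h
      have : η * ((i : ℝ) - j) = 0 := by linarith
      exact (mul_ne_zero (ne_of_gt hη) hij') this
    · refine nhdsWithin_le_nhds ?_
      refine ContinuousAt.eventually_ne ?_ ?_ |>.mono fun η h => sub_ne_zero.1 h
      · fun_prop
      · simpa [sub_eq_zero] using hc
  have h' : ∀ᶠ η : ℝ in nhdsWithin 0 (Set.Ioi 0), ∀ i j : Fin m, i ≠ j →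
      c i + η * ((i : ℝ) + 1) ≠ c j + η * ((j : ℝ) + 1) := by
    simp only [Filter.eventually_all]
    exact h
  filter_upwards [h'] with η hη i j hij
  by_contra hne
  exact hη i j hne hij

/-- The minimal polynomial of `x` can be approximated by squarefree polynomials with imaginary
roots. These are realized by small perturbations of `A`, whose orbits through `x` are recurrent
and at the same time pseudo-orbits for `A`. -/
theorem isLinearlyChainRecurrent_of_aeval_eq_zero [FiniteDimensional ℝ F] [CompleteSpace F]
    {A : F →L[ℝ] F} {x : F} {s : Multiset ℝ} (hs : ∀ c ∈ s, 0 ≤ c)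
    (hx : aeval A (s.map fun c => X ^ 2 + C c).prod x = 0) :
    (expFlow A).IsLinearlyChainRecurrent x := by
  intro δ hδ T hT
  have hs0 : (s.map fun c => (X ^ 2 + C c : ℝ[X])).prod.Monic :=
    monic_multiset_prod_of_monic _ _ fun c _ => monic_X_pow_add_C c two_ne_zero
  obtain ⟨μ, hμm, hμ⟩ := exists_monic_forall_aeval_eq_zero_iff hs0.ne_zero hx
  obtain ⟨m, a, c, ha, hc, hμc⟩ := exists_eq_oscillatorPoly_of_dvd hs hμm ((hμ _).1 hx)
  have hμx : aeval A μ x = 0 := (hμ μ).2 dvd_rfl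
  rcases hk : μ.natDegree with _ | k
  · obtain rfl : μ = 1 := hμm.natDegree_eq_zero.1 hk
    have hx0 : x = 0 := by simpa using hμx
    subst hx0
    have h0 : (expFlow A).toFun T 0 = 0 := ((expFlow A).isLinearMap' T).map_zero
    exact ⟨1, fun _ => 0, le_rfl, rfl, by simpa using hδ.le, fun i => by simp [h0]⟩
  obtain ⟨ℓ, hℓ⟩ := exists_dual_aeval_apply hk hμ
  -- The perturbation with parameter `η`, equal to `A` for `η = 0`.
  let q : ℝ → ℝ[X] := fun η => oscillatorPoly a fun i : Fin m => c i + η * ((i : ℝ) + 1)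
  let B : ℝ → F →L[ℝ] F := fun η => A - ℓ.smulRight (aeval A (q η) x)
  have hq0 : q 0 = μ := by
    rw [hμc]
    simp [q]
  have hB0 : B 0 = A := by
    simp only [B, hq0, hμx]
    ext v
    simp
  have hqc : Continuous fun η => aeval A (q η) x := by
    exact (continuous_aeval_oscillatorPoly A a fun i => by fun_prop).clm_apply continuous_const
  have hBc : Continuous B := by
    have h : B = fun η => A - ContinuousLinearMap.smulRightL ℝ F F ℓ (aeval A (q η) x) := rfl
    rw [h]
    fun_prop
  have hexp : Continuous fun η => NormedSpace.exp (T • B η) :=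
    continuous_exp_clm.comp (hBc.const_smul T)
  set K : ℝ := ‖NormedSpace.exp ((-T) • A)‖ + 1 with hK
  have hKpos : 0 < K := by positivity
  have hev : ∀ᶠ η in nhdsWithin 0 (Set.Ioi 0),
      ‖NormedSpace.exp (T • A) - NormedSpace.exp (T • B η)‖ < δ / K := by
    refine nhdsWithin_le_nhds ?_
    have hcont : Continuous fun η => ‖NormedSpace.exp (T • A) - NormedSpace.exp (T • B η)‖ :=
      (continuous_const.sub hexp).norm
    refine hcont.continuousAt.eventually_lt continuousAt_const ?_
    rw [hB0, sub_self, norm_zero]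
    positivity
  obtain ⟨η, ⟨hclose, hinj⟩, hη⟩ :=
    ((hev.and (eventually_injective_add_mul c)).and self_mem_nhdsWithin).exists
  have hη : 0 < η := hη
  have hann : aeval (B η) (q η) x = 0 := by
    refine aeval_perturbation_apply hℓ (monic_oscillatorPoly _ _) ?_
    rw [← hk, hμc, natDegree_oscillatorPoly, natDegree_oscillatorPoly]
  obtain ⟨n, hn, hret⟩ := (isQuasiPeriodic_of_aeval_oscillatorPoly ha
    (fun i => by have := hc i; positivity) hinj hann).exists_norm_sub_le T hδ
  refine ⟨n, fun i => NormedSpace.exp ((i * T : ℝ) • B η) x, hn, ?_, hret, fun i => ?_⟩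
  · simp
  · set y := NormedSpace.exp ((i * T : ℝ) • B η) x with hy
    have hsucc : NormedSpace.exp (((i + 1 : ℕ) * T : ℝ) • B η) x =
        NormedSpace.exp (T • B η) y := by
      rw [hy, ← exp_smul_apply_add]
      congr 3
      push_cast
      ring
    change ‖NormedSpace.exp (T • A) y - NormedSpace.exp (((i + 1 : ℕ) * T : ℝ) • B η) x‖ ≤
      δ * ‖NormedSpace.exp (T • A) y‖
    rw [hsucc]
    have hyK : ‖y‖ ≤ K * ‖NormedSpace.exp (T • A) y‖ := by
      have h1 : NormedSpace.exp ((-T) • A) (NormedSpace.exp (T • A) y) = y := by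
        rw [← exp_smul_apply_add, neg_add_cancel, exp_zero_smul_apply]
      calc ‖y‖ = ‖NormedSpace.exp ((-T) • A) (NormedSpace.exp (T • A) y)‖ := by rw [h1]
        _ ≤ ‖NormedSpace.exp ((-T) • A)‖ * ‖NormedSpace.exp (T • A) y‖ :=
          ContinuousLinearMap.le_opNorm _ _
        _ ≤ K * ‖NormedSpace.exp (T • A) y‖ := by gcongr; linarith
    calc ‖NormedSpace.exp (T • A) y - NormedSpace.exp (T • B η) y‖
        ≤ ‖NormedSpace.exp (T • A) - NormedSpace.exp (T • B η)‖ * ‖y‖ :=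
          ContinuousLinearMap.le_opNorm (NormedSpace.exp (T • A) - NormedSpace.exp (T • B η)) y
      _ ≤ δ / K * (K * ‖NormedSpace.exp (T • A) y‖) := by gcongr
      _ = δ * ‖NormedSpace.exp (T • A) y‖ := by field_simp

end Perturbation

/-! ### Exponential growth on sums of generalized eigenspaces -/

section Growth

variable {G : Type*} [NormedAddCommGroup G] [NormedSpace ℂ G]

theorem hasSum_exp_apply [CompleteSpace G] (N : G →L[ℂ] G) (w : G) :
    HasSum (fun n : ℕ => ((n.factorial : ℂ)⁻¹) • (N ^ n) w) (NormedSpace.exp N w) :=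
  (NormedSpace.exp_series_hasSum_exp' (𝕂 := ℂ) N).mapL (ContinuousLinearMap.apply ℂ G w)

theorem exp_add_smul_one [CompleteSpace G] (c : ℂ) (N : G →L[ℂ] G) :
    NormedSpace.exp (c • (1 : G →L[ℂ] G) + N) = Complex.exp c • NormedSpace.exp N := by
  let _ : NormedAlgebra ℚ (G →L[ℂ] G) := NormedAlgebra.restrictScalars ℚ ℂ _
  rw [NormedSpace.exp_add_of_commute ((Commute.one_left N).smul_left c),
    ← Algebra.algebraMap_eq_smul_one, ← NormedSpace.algebraMap_exp_comm, ← Complex.exp_eq_exp_ℂ,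
    Algebra.algebraMap_eq_smul_one, smul_mul_assoc, one_mul]

/-- On a generalized eigenvector the exponential is a polynomial in `t` times `exp(tμ)`. -/
theorem tendsto_exp_smul_apply_of_re_neg [CompleteSpace G] {Λ : G →L[ℂ] G} {μ : ℂ} (hμ : μ.re < 0)
    {w : G} {k : ℕ} (hw : ((Λ - μ • (1 : G →L[ℂ] G)) ^ k) w = 0) :
    Filter.Tendsto (fun t : ℝ => NormedSpace.exp ((t : ℂ) • Λ) w) Filter.atTop (nhds 0) := by
  set N := Λ - μ • (1 : G →L[ℂ] G) with hN
  have hformula : ∀ t : ℝ, NormedSpace.exp ((t : ℂ) • Λ) w =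
      ∑ j ∈ Finset.range k, (Complex.exp (t * μ) * ((j.factorial : ℂ)⁻¹ * (t : ℂ) ^ j)) •
        (N ^ j) w := by
    intro t
    have h1 : (t : ℂ) • Λ = (t * μ) • (1 : G →L[ℂ] G) + (t : ℂ) • N := by
      rw [hN, smul_sub, smul_smul, add_sub_cancel]
    rw [h1, exp_add_smul_one, smul_apply]
    have h2 : NormedSpace.exp ((t : ℂ) • N) w =
        ∑ j ∈ Finset.range k, ((j.factorial : ℂ)⁻¹) • (((t : ℂ) • N) ^ j) w := by
      refine (hasSum_exp_apply _ w).unique (hasSum_sum_of_ne_finset_zero fun j hj => ?_)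
      obtain ⟨i, rfl⟩ := Nat.exists_eq_add_of_le (not_lt.1 (fun h => hj (Finset.mem_range.2 h)))
      rw [smul_pow, smul_apply, add_comm k i, pow_add N, mul_apply_eq_comp, hw, map_zero, smul_zero,
        smul_zero]
    rw [h2, Finset.smul_sum]
    refine Finset.sum_congr rfl fun j _ => ?_
    rw [smul_pow, smul_apply, smul_smul, smul_smul, mul_assoc]
  simp only [hformula]
  rw [← Finset.sum_const_zero (s := Finset.range k)]
  refine tendsto_finsetSum _ fun j _ => ?_
  rw [tendsto_zero_iff_norm_tendsto_zero]
  have hlim : Filter.Tendsto (fun t : ℝ => (t ^ j * Real.exp (-(-μ.re) * t)) *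
      ((j.factorial : ℝ)⁻¹ * ‖(N ^ j) w‖)) Filter.atTop (nhds 0) := by
    have h := (tendsto_rpow_mul_exp_neg_mul_atTop_nhds_zero (j : ℝ) (-μ.re) (by linarith)).mul_const
      ((j.factorial : ℝ)⁻¹ * ‖(N ^ j) w‖)
    simpa only [Real.rpow_natCast, zero_mul] using h
  refine hlim.congr' ?_
  filter_upwards [Filter.eventually_ge_atTop 0] with t ht
  rw [norm_smul, norm_mul, norm_mul, Complex.norm_exp, norm_inv, norm_pow, Complex.norm_natCast,
    Complex.norm_real, Real.norm_of_nonneg ht, Complex.re_ofReal_mul]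
  ring_nf

/-- In finite dimension pointwise convergence to zero is uniform. -/
theorem eventually_norm_apply_le [FiniteDimensional ℂ G] {u : ℝ → G →L[ℂ] G}
    (hu : ∀ z, Filter.Tendsto (fun t => u t z) Filter.atTop (nhds 0)) {M : ℝ} (hM : 0 < M) :
    ∀ᶠ t in Filter.atTop, ∀ z, ‖u t z‖ ≤ M * ‖z‖ := by
  obtain ⟨C, hC, h⟩ := (Module.finBasis ℂ G).exists_opNorm_le (F := G)
  have h1 : ∀ᶠ t in Filter.atTop, ∀ i, ‖u t (Module.finBasis ℂ G i)‖ ≤ M / C := by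
    rw [Filter.eventually_all]
    intro i
    have h2 := (hu (Module.finBasis ℂ G i)).norm
    rw [norm_zero] at h2
    exact h2.eventually_le_const (div_pos hM hC)
  filter_upwards [h1] with t ht z
  refine ((u t).le_opNorm z).trans ?_
  gcongr
  calc ‖u t‖ ≤ C * (M / C) := h (div_pos hM hC).le ht
    _ = M := by field_simp

theorem exp_neg_apply_exp_apply [CompleteSpace G] (N : G →L[ℂ] G) (v : G) :
    NormedSpace.exp (-N) (NormedSpace.exp N v) = v := by
  let _ : NormedAlgebra ℚ (G →L[ℂ] G) := NormedAlgebra.restrictScalars ℚ ℂ _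
  rw [← mul_apply_eq_comp, ← NormedSpace.exp_add_of_commute (Commute.refl N).neg_left,
    neg_add_cancel, NormedSpace.exp_zero, one_apply_eq_self]

theorem apply_exp_smul_apply [CompleteSpace G] {N P : G →L[ℂ] G} (h : Commute N P) (c : ℂ) (v : G) :
    P (NormedSpace.exp (c • N) v) = NormedSpace.exp (c • N) (P v) := by
  let _ : NormedAlgebra ℚ (G →L[ℂ] G) := NormedAlgebra.restrictScalars ℚ ℂ _
  have h' : Commute (NormedSpace.exp (c • N)) P := (h.smul_left c).exp_left
  rw [← mul_apply_eq_comp, ← mul_apply_eq_comp, h'.eq]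

/-- If, relative to the rate `exp(tη)`, the image of the projection `P` is expanded and its kernel
is contracted, then every cone around the image of `P` is mapped into a cone of half the width
after a time that does not depend on the cone. -/
theorem exists_forall_norm_sub_le_of_tendsto [FiniteDimensional ℂ G] [CompleteSpace G]
    {Λ P : G →L[ℂ] G} {η : ℝ} (hP : ∀ z, P (P z) = P z) (hc : Commute Λ P)
    (h1 : ∀ z, Filter.Tendsto
      (fun t : ℝ => NormedSpace.exp ((t : ℂ) • -(Λ - (η : ℂ) • (1 : G →L[ℂ] G))) (P z))
      Filter.atTop (nhds 0))
    (h2 : ∀ z, Filter.Tendsto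
      (fun t : ℝ => NormedSpace.exp ((t : ℂ) • (Λ - (η : ℂ) • (1 : G →L[ℂ] G))) (z - P z))
      Filter.atTop (nhds 0)) :
    ∃ T > 0, ∀ t : ℝ, T ≤ t → ∀ (z : G) (κ : ℝ), 0 ≤ κ → ‖z - P z‖ ≤ κ * ‖P z‖ →
      ‖NormedSpace.exp ((t : ℂ) • Λ) z - P (NormedSpace.exp ((t : ℂ) • Λ) z)‖ ≤
        κ / 2 * ‖P (NormedSpace.exp ((t : ℂ) • Λ) z)‖ := by
  set N := Λ - (η : ℂ) • (1 : G →L[ℂ] G) with hN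
  have hcN : Commute N P := hc.sub_left ((Commute.one_left P).smul_left _)
  have e1 : ∀ᶠ t : ℝ in Filter.atTop, ∀ z,
      ‖NormedSpace.exp ((t : ℂ) • -N) (P z)‖ ≤ 1 / 2 * ‖z‖ :=
    eventually_norm_apply_le (u := fun t : ℝ => (NormedSpace.exp ((t : ℂ) • -N)).comp P) h1
      (by norm_num)
  have e2 : ∀ᶠ t : ℝ in Filter.atTop, ∀ z,
      ‖NormedSpace.exp ((t : ℂ) • N) (z - P z)‖ ≤ 1 * ‖z‖ :=
    eventually_norm_apply_le
      (u := fun t : ℝ => (NormedSpace.exp ((t : ℂ) • N)).comp (ContinuousLinearMap.id ℂ G - P)) h2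
      one_pos
  obtain ⟨T, hT⟩ := Filter.eventually_atTop.1 ((e1.and e2).and (Filter.eventually_gt_atTop 0))
  refine ⟨T, (hT T le_rfl).2, fun t ht z κ hκ hz => ?_⟩
  obtain ⟨⟨hE, hF⟩, -⟩ := hT t ht
  set y := NormedSpace.exp ((t : ℂ) • N) z with hy
  have hPy : P y = NormedSpace.exp ((t : ℂ) • N) (P z) :=
    apply_exp_smul_apply hcN _ _
  have hΛ : NormedSpace.exp ((t : ℂ) • Λ) z = Complex.exp (t * η) • y := by
    have h : (t : ℂ) • Λ = (t * η : ℂ) • (1 : G →L[ℂ] G) + (t : ℂ) • N := by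
      rw [hN, smul_sub, smul_smul, add_sub_cancel]
    rw [h, exp_add_smul_one, smul_apply]
  have hk : ‖y - P y‖ ≤ κ / 2 * ‖P y‖ := by
    have b1 : ‖P z‖ ≤ 1 / 2 * ‖P y‖ := by
      have h := hE (P y)
      rwa [hP, hPy, smul_neg, exp_neg_apply_exp_apply, ← hPy] at h
    have b2 : ‖y - P y‖ ≤ 1 * ‖z - P z‖ := by
      have h := hF (z - P z)
      rwa [map_sub P, hP, sub_self, sub_zero, map_sub, ← hPy] at h
    calc ‖y - P y‖ ≤ κ * ‖P z‖ := by linarith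
      _ ≤ κ * (1 / 2 * ‖P y‖) := by gcongr
      _ = κ / 2 * ‖P y‖ := by ring
  rw [hΛ, map_smul, ← smul_sub, norm_smul, norm_smul]
  calc ‖Complex.exp (t * η)‖ * ‖y - P y‖ ≤ ‖Complex.exp (t * η)‖ * (κ / 2 * ‖P y‖) := by gcongr
    _ = κ / 2 * (‖Complex.exp (t * η)‖ * ‖P y‖) := by ring

end Growth

/-! ### Dominated splittings and chains in projective space -/

section Domination

variable {F G : Type*} [NormedAddCommGroup F] [NormedSpace ℝ F] [NormedAddCommGroup G]
  [NormedSpace ℝ G]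

/-- A forward invariant cone condition: `Q` and `R` are the components of a vector with respect to
a splitting (with values in a common space `G`), and for large times the flow halves the width of
every cone `‖R x‖ ≤ κ ‖Q x‖`. -/
def LinearFlow.IsDominated (φ : LinearFlow F) (Q R : F →L[ℝ] G) : Prop :=
  ∃ T > 0, ∀ t : ℝ, T ≤ t → ∀ (x : F) (κ : ℝ), 0 ≤ κ → ‖R x‖ ≤ κ * ‖Q x‖ →
    ‖R (φ.toFun t x)‖ ≤ κ / 2 * ‖Q (φ.toFun t x)‖

/-- Sufficiently small jumps after sufficiently long times do not leave a cone whose width is halved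
by the flow. -/
theorem LinearFlow.IsDominated.notMem_chainLimitSet {φ : LinearFlow F} {Q R : F →L[ℝ] G}
    (h : φ.IsDominated Q R) {C : ℝ} (hC : ∀ x, ‖x‖ ≤ C * (‖Q x‖ + ‖R x‖)) {κ : ℝ} (hκ : 0 < κ)
    {x y : Metric.sphere (0 : F) 1} (hx : ‖R x‖ ≤ κ * ‖Q x‖) (hy : κ * ‖Q y‖ < ‖R y‖) :
    sphereToProj y ∉ chainLimitSet φ.projFlow (sphereToProj x) := by
  obtain ⟨T, hT, hdom⟩ := h
  have hCpos : 0 < C := by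
    have h1 := hC x
    rw [norm_eq_of_mem_sphere x] at h1
    by_contra hneg
    have h2 : 0 ≤ ‖Q x‖ + ‖R x‖ := by positivity
    nlinarith
  set D : ℝ := ‖R‖ + κ * ‖Q‖ + 1 with hD
  have hDpos : 0 < D := by positivity
  set ε : ℝ := κ / 2 / (C * (1 + κ) * D) with hε
  have hεpos : 0 < ε := by positivity
  have hjump : ∀ u w : F, ‖u‖ = 1 → ‖R u‖ ≤ κ / 2 * ‖Q u‖ → ‖u - w‖ < ε →
      ‖R w‖ ≤ κ * ‖Q w‖ := by
    intro u w hu hRu huw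
    have b1 : ‖R w‖ ≤ ‖R u‖ + ‖R‖ * ε := by
      have h1 : ‖R (u - w)‖ ≤ ‖R‖ * ε := (R.le_opNorm _).trans (by gcongr)
      rw [map_sub] at h1
      linarith [norm_sub_norm_le (R w) (R u), norm_sub_rev (R w) (R u)]
    have b2 : ‖Q u‖ ≤ ‖Q w‖ + ‖Q‖ * ε := by
      have h1 : ‖Q (u - w)‖ ≤ ‖Q‖ * ε := (Q.le_opNorm _).trans (by gcongr)
      rw [map_sub] at h1
      linarith [norm_sub_norm_le (Q u) (Q w)]
    have b3 : 1 ≤ C * (1 + κ) * ‖Q u‖ := by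
      have h1 := hC u
      rw [hu] at h1
      have h2 : ‖R u‖ ≤ κ * ‖Q u‖ := hRu.trans (by gcongr; linarith)
      calc 1 ≤ C * (‖Q u‖ + ‖R u‖) := h1
        _ ≤ C * (‖Q u‖ + κ * ‖Q u‖) := by gcongr
        _ = C * (1 + κ) * ‖Q u‖ := by ring
    have b4 : D * ε ≤ κ / 2 * ‖Q u‖ := by
      have h1 : D * ε = κ / 2 / (C * (1 + κ)) := by
        rw [hε]
        field_simp
      rw [h1, div_le_iff₀ (by positivity)]
      nlinarith
    have b5 : (‖R‖ + κ * ‖Q‖) * ε ≤ D * ε := by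
      gcongr
      linarith
    nlinarith [mul_le_mul_of_nonneg_left b2 hκ.le]
  have hstep : ∀ p q : ℙ ℝ F, ChainStep φ.projFlow ε T p q →
      (∀ v, sphereToProj v = p → ‖R v‖ ≤ κ * ‖Q v‖) →
      ∀ w, sphereToProj w = q → ‖R w‖ ≤ κ * ‖Q w‖ := by
    rintro p q ⟨t, ht, hd⟩ hp w rfl
    obtain ⟨v, rfl⟩ := sphereToProj_surjective p
    rw [← sphereToProj_sphereFlow, dist_sphereToProj, min_lt_iff] at hd
    set u := φ.sphereFlow t v with hu
    have hRu : ‖R u‖ ≤ κ / 2 * ‖Q u‖ := by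
      have huv : (u : F) = ‖φ.toFun t v‖⁻¹ • φ.toFun t v := rfl
      have h1 := hdom t ht v κ hκ.le (hp v rfl)
      rw [huv, map_smul, map_smul, norm_smul, norm_smul]
      calc ‖‖φ.toFun t v‖⁻¹‖ * ‖R (φ.toFun t v)‖
          ≤ ‖‖φ.toFun t v‖⁻¹‖ * (κ / 2 * ‖Q (φ.toFun t v)‖) := by gcongr
        _ = κ / 2 * (‖‖φ.toFun t v‖⁻¹‖ * ‖Q (φ.toFun t v)‖) := by ring
    rcases hd with hd | hd
    · exact hjump u w (norm_eq_of_mem_sphere u) hRu hd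
    · have h1 := hjump u (-w) (norm_eq_of_mem_sphere u) hRu (by rwa [sub_neg_eq_add])
      rwa [map_neg, map_neg, norm_neg, norm_neg] at h1
  intro hchain
  have hp : ∀ v, sphereToProj v = sphereToProj x → ‖R v‖ ≤ κ * ‖Q v‖ := by
    intro v hv
    rcases sphereToProj_eq_iff.1 hv with rfl | rfl
    · exact hx
    · rwa [coe_neg_sphere, map_neg, map_neg, norm_neg, norm_neg]
  have key : ∀ q, Relation.TransGen (ChainStep φ.projFlow ε T) (sphereToProj x) q →
      ∀ w, sphereToProj w = q → ‖R w‖ ≤ κ * ‖Q w‖ := by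
    intro q hq
    induction hq with
    | single h => exact hstep _ _ h hp
    | tail _ h ih => exact hstep _ _ h ih
  exact hy.not_ge (key _ (existsChain_iff_transGen.1 (hchain ε hεpos T hT)) y rfl)

end Domination

/-! ### The central subspace and its complexification -/

section Central

open Polynomial

variable {d : ℕ}

/-- The inclusion of `ℝ^d` into `ℂ^d`. -/
def complexify (d : ℕ) : EuclideanSpace ℝ (Fin d) →L[ℝ] (Fin d → ℂ) :=
  LinearMap.toContinuousLinearMap
    { toFun := fun x i => (x i : ℂ)
      map_add' := fun x y => by ext i; simp
      map_smul' := fun c x => by ext i; simp }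

/-- The real part of a complex vector. -/
def reVec (d : ℕ) : (Fin d → ℂ) →L[ℝ] EuclideanSpace ℝ (Fin d) :=
  LinearMap.toContinuousLinearMap
    { toFun := fun w => WithLp.toLp 2 fun i => (w i).re
      map_add' := fun x y => by ext i; simp
      map_smul' := fun c x => by ext i; simp }

@[simp] theorem complexify_apply (x : EuclideanSpace ℝ (Fin d)) (i : Fin d) :
    complexify d x i = (x i : ℂ) := rfl

@[simp] theorem reVec_apply (w : Fin d → ℂ) (i : Fin d) : reVec d w i = (w i).re := rfl

theorem reVec_complexify (x : EuclideanSpace ℝ (Fin d)) : reVec d (complexify d x) = x := by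
  ext i
  simp

/-- The action of a real matrix on `ℂ^d`. -/
abbrev complexEnd (A : Matrix (Fin d) (Fin d) ℝ) : Module.End ℂ (Fin d → ℂ) :=
  Matrix.toLin' (A.map (fun r : ℝ => (r : ℂ)))

theorem complexEnd_apply (A : Matrix (Fin d) (Fin d) ℝ) (w : Fin d → ℂ) (i : Fin d) :
    complexEnd A w i = ∑ j, (A i j : ℂ) * w j := by
  simp [Matrix.mulVec, dotProduct]

theorem toEuclideanCLM_apply_coord (A : Matrix (Fin d) (Fin d) ℝ) (x : EuclideanSpace ℝ (Fin d))
    (i : Fin d) : Matrix.toEuclideanCLM (𝕜 := ℝ) A x i = ∑ j, A i j * x j := rfl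

theorem complexEnd_complexify (A : Matrix (Fin d) (Fin d) ℝ) (x : EuclideanSpace ℝ (Fin d)) :
    complexEnd A (complexify d x) = complexify d (Matrix.toEuclideanCLM (𝕜 := ℝ) A x) := by
  ext i
  rw [complexEnd_apply, complexify_apply, toEuclideanCLM_apply_coord]
  push_cast
  rfl

theorem reVec_complexEnd (A : Matrix (Fin d) (Fin d) ℝ) (w : Fin d → ℂ) :
    reVec d (complexEnd A w) = Matrix.toEuclideanCLM (𝕜 := ℝ) A (reVec d w) := by
  ext i
  rw [reVec_apply, complexEnd_apply, toEuclideanCLM_apply_coord, Complex.re_sum]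
  exact Finset.sum_congr rfl fun j _ => Complex.re_ofReal_mul _ _

theorem star_complexEnd (A : Matrix (Fin d) (Fin d) ℝ) (w : Fin d → ℂ) :
    star (complexEnd A w) = complexEnd A (star w) := by
  ext i
  rw [Pi.star_apply, complexEnd_apply, complexEnd_apply, star_sum]
  refine Finset.sum_congr rfl fun j _ => ?_
  rw [star_mul', Pi.star_apply]
  congr 1
  exact Complex.conj_ofReal _

/-- The sum of the complex generalized eigenspaces for the numbers in `S`. -/
def genEigenspaceSum (A : Matrix (Fin d) (Fin d) ℝ) (S : Set ℂ) : Submodule ℂ (Fin d → ℂ) :=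
  ⨆ μ ∈ S, Module.End.maxGenEigenspace (complexEnd A) μ

theorem maxGenEigenspace_le_genEigenspaceSum (A : Matrix (Fin d) (Fin d) ℝ) {S : Set ℂ} {μ : ℂ}
    (hμ : μ ∈ S) : Module.End.maxGenEigenspace (complexEnd A) μ ≤ genEigenspaceSum A S :=
  le_iSup₂_of_le μ hμ le_rfl

theorem genEigenspaceSum_mono (A : Matrix (Fin d) (Fin d) ℝ) {S S' : Set ℂ} (h : S ⊆ S') :
    genEigenspaceSum A S ≤ genEigenspaceSum A S' :=
  biSup_mono h

theorem maxGenEigenspace_eq_bot_of_notMem_spectrum {A : Matrix (Fin d) (Fin d) ℝ} {μ : ℂ}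
    (hμ : μ ∉ spectrum ℂ (A.map (fun r : ℝ => (r : ℂ)))) :
    Module.End.maxGenEigenspace (complexEnd A) μ = ⊥ := by
  rw [← Matrix.spectrum_toLin', ← Module.End.hasEigenvalue_iff_mem_spectrum,
    Module.End.hasEigenvalue_iff, not_not] at hμ
  rw [eq_bot_iff]
  intro w hw
  obtain ⟨k, hk⟩ := (Module.End.mem_maxGenEigenspace _ _ _).1 hw
  induction k with
  | zero => simpa using hk
  | succ k ih =>
    refine ih ?_
    rw [pow_succ'] at hk
    have h : ((complexEnd A - μ • 1) ^ k) w ∈ Module.End.eigenspace (complexEnd A) μ := by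
      rw [Module.End.mem_eigenspace_iff, ← sub_eq_zero]
      exact hk
    rw [hμ] at h
    exact h

/-- Vectors of the central subspace are annihilated by products of polynomials `X ^ 2 + c`, `c ≥ 0`:
for `μ = iω` one has `X ^ 2 + ω ^ 2 = (X - μ) (X + μ)`. -/
theorem exists_aeval_prod_eq_zero_of_mem_centralSubspace {A : Matrix (Fin d) (Fin d) ℝ}
    {x : EuclideanSpace ℝ (Fin d)} (hx : x ∈ centralSubspace A) :
    ∃ s : Multiset ℝ, (∀ c ∈ s, 0 ≤ c) ∧
      aeval (Matrix.toEuclideanCLM (𝕜 := ℝ) A)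
        (s.map fun c => (X ^ 2 + C c : ℝ[X])).prod x = 0 := by
  set a := Matrix.toEuclideanCLM (𝕜 := ℝ) A with ha
  let W : Submodule ℝ (EuclideanSpace ℝ (Fin d)) :=
    { carrier := {x | ∃ s : Multiset ℝ, (∀ c ∈ s, 0 ≤ c) ∧
        aeval a (s.map fun c => (X ^ 2 + C c : ℝ[X])).prod x = 0}
      add_mem' := by
        rintro x y ⟨s, hs, hsx⟩ ⟨t, ht, hty⟩
        refine ⟨s + t, fun c hc => (Multiset.mem_add.1 hc).elim (hs c) (ht c), ?_⟩
        rw [Multiset.map_add, Multiset.prod_add, map_add]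
        have h1 : aeval a ((s.map fun c => (X ^ 2 + C c : ℝ[X])).prod *
            (t.map fun c => (X ^ 2 + C c : ℝ[X])).prod) x = 0 := by
          rw [mul_comm, map_mul, mul_apply_eq_comp, hsx, map_zero]
        have h2 : aeval a ((s.map fun c => (X ^ 2 + C c : ℝ[X])).prod *
            (t.map fun c => (X ^ 2 + C c : ℝ[X])).prod) y = 0 := by
          rw [map_mul, mul_apply_eq_comp, hty, map_zero]
        rw [h1, h2, add_zero]
      zero_mem' := ⟨0, by simp, by simp⟩
      smul_mem' := by
        rintro r x ⟨s, hs, hsx⟩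
        exact ⟨s, hs, by rw [map_smul, hsx, smul_zero]⟩ }
  have hgen : ∀ μ : ℂ, μ.re = 0 → ∀ w ∈ Module.End.maxGenEigenspace (complexEnd A) μ,
      reVec d w ∈ W := by
    intro μ hμ w hw
    obtain ⟨k, hk⟩ := (Module.End.mem_maxGenEigenspace _ _ _).1 hw
    refine ⟨Multiset.replicate k (μ.im ^ 2), fun c hc => ?_, ?_⟩
    · rw [Multiset.eq_of_mem_replicate hc]
      positivity
    · have hfac : complexEnd A * complexEnd A + ((μ.im ^ 2 : ℝ) : ℂ) • 1 =
          (complexEnd A + μ • 1) * (complexEnd A - μ • 1) := by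
        have hμ2 : ((μ.im ^ 2 : ℝ) : ℂ) = -(μ * μ) := by
          apply Complex.ext <;> simp [hμ, sq]
        rw [hμ2, add_mul, mul_sub, mul_sub, smul_mul_assoc, one_mul, mul_smul_comm, mul_one,
          smul_mul_smul_comm, one_mul]
        module
      have hcomm : Commute (complexEnd A + μ • 1) (complexEnd A - μ • 1) := by
        have h1 : Commute (complexEnd A) (μ • 1 : Module.End ℂ (Fin d → ℂ)) :=
          (Commute.one_right _).smul_right μ
        exact ((Commute.refl _).sub_right h1).add_left (h1.symm.sub_right (Commute.refl _))
      have hzero : ((complexEnd A * complexEnd A + ((μ.im ^ 2 : ℝ) : ℂ) • 1) ^ k) w = 0 := by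
        rw [hfac, hcomm.mul_pow, Module.End.mul_apply, hk, map_zero]
      have hsemi : ∀ (j : ℕ), aeval a ((X ^ 2 + C (μ.im ^ 2) : ℝ[X]) ^ j) (reVec d w) =
          reVec d (((complexEnd A * complexEnd A + ((μ.im ^ 2 : ℝ) : ℂ) • 1) ^ j) w) := by
        intro j
        induction j with
        | zero => simp
        | succ j ih =>
          rw [pow_succ' _ j, map_mul, mul_apply_eq_comp, ih, pow_succ' _ j, Module.End.mul_apply]
          set v := ((complexEnd A * complexEnd A + ((μ.im ^ 2 : ℝ) : ℂ) • 1) ^ j) w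
          have hv : reVec d ((complexEnd A * complexEnd A + ((μ.im ^ 2 : ℝ) : ℂ) • 1) v) =
              a (a (reVec d v)) + (μ.im ^ 2) • reVec d v := by
            rw [LinearMap.add_apply, map_add, Module.End.mul_apply, reVec_complexEnd,
              reVec_complexEnd, LinearMap.smul_apply, Module.End.one_apply, Complex.coe_smul,
              map_smul]
          rw [hv, map_add, map_pow, aeval_X, aeval_C, Algebra.algebraMap_eq_smul_one, pow_two a]
          rfl
      rw [Multiset.map_replicate, Multiset.prod_replicate, hsemi, hzero, map_zero]
  have hle : centralSubspace A ≤ W := by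
    refine iSup₂_le fun μ hμ => Submodule.span_le.2 ?_
    rintro y ⟨w, hw, hy | hy⟩
    · have : y = reVec d w := by
        ext i
        exact hy i
      rw [this]
      exact hgen μ hμ.2 w hw
    · have : y = reVec d ((-Complex.I) • w) := by
        ext i
        simp [hy i]
      rw [this]
      exact hgen μ hμ.2 _ (Submodule.smul_mem _ _ hw)
  exact hle hx

theorem star_mem_maxGenEigenspace {A : Matrix (Fin d) (Fin d) ℝ} {μ : ℂ} {w : Fin d → ℂ}
    (hw : w ∈ Module.End.maxGenEigenspace (complexEnd A) μ) :
    star w ∈ Module.End.maxGenEigenspace (complexEnd A) (star μ) := by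
  obtain ⟨k, hk⟩ := (Module.End.mem_maxGenEigenspace _ _ _).1 hw
  refine (Module.End.mem_maxGenEigenspace _ _ _).2 ⟨k, ?_⟩
  have h : ∀ j : ℕ, ((complexEnd A - star μ • 1) ^ j) (star w) =
      star (((complexEnd A - μ • 1) ^ j) w) := by
    intro j
    induction j with
    | zero => simp
    | succ j ih =>
      rw [pow_succ', pow_succ', Module.End.mul_apply, Module.End.mul_apply, ih, LinearMap.sub_apply,
        LinearMap.sub_apply, star_sub, star_complexEnd, LinearMap.smul_apply, LinearMap.smul_apply,
        star_smul]
      rfl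
  rw [h, hk, star_zero]

/-- The real part of a generalized eigenvector for `μ` is half its sum with its conjugate, which
is a generalized eigenvector for the conjugate of `μ`. -/
theorem complexify_mem_of_mem_centralSubspace {A : Matrix (Fin d) (Fin d) ℝ}
    {x : EuclideanSpace ℝ (Fin d)} (hx : x ∈ centralSubspace A) :
    complexify d x ∈ genEigenspaceSum A {μ | μ.re = 0} := by
  have hgen : ∀ μ : ℂ, μ.re = 0 → ∀ w ∈ Module.End.maxGenEigenspace (complexEnd A) μ,
      complexify d (reVec d w) ∈ genEigenspaceSum A {μ | μ.re = 0} := by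
    intro μ hμ w hw
    have h : complexify d (reVec d w) = (1 / 2 : ℂ) • (w + star w) := by
      ext i
      have := Complex.re_eq_add_conj (w i)
      simp only [complexify_apply, reVec_apply, this, Pi.smul_apply, Pi.add_apply, Pi.star_apply,
        smul_eq_mul, Complex.star_def]
      ring
    rw [h]
    refine Submodule.smul_mem _ _ (Submodule.add_mem _ ?_ ?_)
    · exact maxGenEigenspace_le_genEigenspaceSum A hμ hw
    · refine maxGenEigenspace_le_genEigenspaceSum A ?_ (star_mem_maxGenEigenspace hw)
      simpa using hμ
  have hle : centralSubspace A ≤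
      ((genEigenspaceSum A {μ | μ.re = 0}).restrictScalars ℝ).comap
        (complexify d : EuclideanSpace ℝ (Fin d) →ₗ[ℝ] (Fin d → ℂ)) := by
    refine iSup₂_le fun μ hμ => Submodule.span_le.2 ?_
    rintro y ⟨w, hw, hy | hy⟩
    · have : y = reVec d w := by
        ext i
        exact hy i
      rw [this]
      exact hgen μ hμ.2 w hw
    · have : y = reVec d ((-Complex.I) • w) := by
        ext i
        simp [hy i]
      rw [this]
      exact hgen μ hμ.2 _ (Submodule.smul_mem _ _ hw)
  exact hle hx

theorem mem_centralSubspace_of_complexify_mem {A : Matrix (Fin d) (Fin d) ℝ}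
    {x : EuclideanSpace ℝ (Fin d)} (hx : complexify d x ∈ genEigenspaceSum A {μ | μ.re = 0}) :
    x ∈ centralSubspace A := by
  let W : Submodule ℂ (Fin d → ℂ) :=
    { carrier := {w | ∀ c : ℂ, reVec d (c • w) ∈ centralSubspace A}
      add_mem' := fun {v w} hv hw c => by
        rw [smul_add, map_add]
        exact Submodule.add_mem _ (hv c) (hw c)
      zero_mem' := fun c => by simp
      smul_mem' := fun b w hw c => by
        rw [smul_smul]
        exact hw (c * b) }
  have hle : genEigenspaceSum A {μ | μ.re = 0} ≤ W := by
    refine iSup₂_le fun μ hμ w hw c => ?_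
    by_cases hs : μ ∈ spectrum ℂ (A.map (fun r : ℝ => (r : ℂ)))
    · have h : realGenEigenspace A μ ≤ centralSubspace A := le_iSup₂_of_le μ ⟨hs, hμ⟩ le_rfl
      exact h (Submodule.subset_span ⟨c • w, Submodule.smul_mem _ _ hw, Or.inl fun i => rfl⟩)
    · rw [maxGenEigenspace_eq_bot_of_notMem_spectrum hs, Submodule.mem_bot] at hw
      simp [hw]
  have h := hle hx 1
  rwa [one_smul, reVec_complexify] at h

theorem genEigenspaceSum_inf_le (A : Matrix (Fin d) (Fin d) ℝ) (S S' : Set ℂ) :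
    genEigenspaceSum A S ⊓ genEigenspaceSum A S' ≤ genEigenspaceSum A (S ∩ S') := by
  have hS : genEigenspaceSum A S = genEigenspaceSum A (S ∩ S') ⊔ genEigenspaceSum A (S \ S') := by
    unfold genEigenspaceSum
    rw [← iSup_union, Set.inter_union_sdiff]
  have hle : genEigenspaceSum A (S ∩ S') ≤ genEigenspaceSum A S' :=
    biSup_mono fun μ hμ => hμ.2
  have hdisj : Disjoint (genEigenspaceSum A (S \ S')) (genEigenspaceSum A S') :=
    (Module.End.independent_maxGenEigenspace (complexEnd A)).disjoint_biSup_biSup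
      Set.disjoint_sdiff_left
  rw [hS, sup_inf_assoc_of_le _ hle, hdisj.eq_bot, sup_bot_eq]

/-! ### The dominated splittings of a matrix flow -/

/-- The exponential series commutes with the inclusion of `ℝ^d` into `ℂ^d`. -/
theorem complexify_exp (A : Matrix (Fin d) (Fin d) ℝ) (t : ℝ) (x : EuclideanSpace ℝ (Fin d)) :
    complexify d ((matrixFlow A).toFun t x) =
      NormedSpace.exp ((t : ℂ) • LinearMap.toContinuousLinearMap (complexEnd A))
        (complexify d x) := by
  set a := Matrix.toEuclideanCLM (𝕜 := ℝ) A with ha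
  set Λ := LinearMap.toContinuousLinearMap (complexEnd A) with hΛ
  have h1 : HasSum (fun n : ℕ => complexify d ((((n.factorial : ℝ)⁻¹) • (t • a) ^ n) x))
      (complexify d ((matrixFlow A).toFun t x)) :=
    (complexify d).hasSum ((NormedSpace.exp_series_hasSum_exp' (𝕂 := ℝ) (t • a)).mapL
      (ContinuousLinearMap.apply ℝ _ x))
  have hstep : ∀ y, complexify d ((t • a) y) = ((t : ℂ) • Λ) (complexify d y) := by
    intro y
    rw [smul_apply, smul_apply, map_smul, ha, ← complexEnd_complexify, Complex.coe_smul]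
    rfl
  have hpow : ∀ n : ℕ, complexify d (((t • a) ^ n) x) =
      (((t : ℂ) • Λ) ^ n) (complexify d x) := by
    intro n
    induction n with
    | zero => simp
    | succ n ih =>
      rw [pow_succ', pow_succ', mul_apply_eq_comp, mul_apply_eq_comp, ← ih, hstep]
  have hterm : ∀ n : ℕ, complexify d ((((n.factorial : ℝ)⁻¹) • (t • a) ^ n) x) =
      ((n.factorial : ℂ)⁻¹) • (((t : ℂ) • Λ) ^ n) (complexify d x) := by
    intro n
    rw [smul_apply, map_smul, hpow]
    ext i
    simp
  rw [funext hterm] at h1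
  exact h1.unique (hasSum_exp_apply _ _)

/-- The projection onto the sum of the generalized eigenspaces with `η < Re μ` along the sum of
those with `Re μ < η` gives a dominated splitting of `ℝ^d` with components in `ℂ^d`, provided that
no eigenvalue has real part `η`. -/
theorem exists_dominated_projection {A : Matrix (Fin d) (Fin d) ℝ} {η : ℝ}
    (hη : ∀ μ ∈ spectrum ℂ (A.map (fun r : ℝ => (r : ℂ))), μ.re ≠ η) :
    ∃ P : (Fin d → ℂ) →L[ℝ] (Fin d → ℂ),
      (∀ z, P z = 0 ↔ z ∈ genEigenspaceSum A {μ | μ.re < η}) ∧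
      (∀ z, P z = z ↔ z ∈ genEigenspaceSum A {μ | η < μ.re}) ∧
      (matrixFlow A).IsDominated (P.comp (complexify d))
        (complexify d - P.comp (complexify d)) := by
  set Λ := LinearMap.toContinuousLinearMap (complexEnd A) with hΛ
  set E := genEigenspaceSum A {μ | η < μ.re} with hE
  set F := genEigenspaceSum A {μ | μ.re < η} with hF
  have hcompl : IsCompl E F := by
    refine ⟨(Module.End.independent_maxGenEigenspace (complexEnd A)).disjoint_biSup_biSup ?_, ?_⟩
    · rw [Set.disjoint_left]
      intro μ h1 h2
      exact lt_asymm (α := ℝ) h1 h2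
    · rw [codisjoint_iff, eq_top_iff, ← Module.End.iSup_maxGenEigenspace_eq_top (complexEnd A)]
      refine iSup_le fun μ => ?_
      rcases lt_trichotomy μ.re η with h | h | h
      · exact (maxGenEigenspace_le_genEigenspaceSum A h).trans le_sup_right
      · rw [maxGenEigenspace_eq_bot_of_notMem_spectrum fun hs => hη μ hs h]
        exact bot_le
      · exact (maxGenEigenspace_le_genEigenspaceSum A h).trans le_sup_left
  have hinv : ∀ S : Set ℂ, ∀ z ∈ genEigenspaceSum A S, Λ z ∈ genEigenspaceSum A S := by
    intro S
    have h : genEigenspaceSum A S ≤ (genEigenspaceSum A S).comap (complexEnd A) :=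
      iSup₂_le fun μ hμ w hw => maxGenEigenspace_le_genEigenspaceSum A hμ
        (Module.End.mapsTo_maxGenEigenspace_of_comm (Commute.refl _) μ hw)
    exact h
  have hpow : ∀ (μ : ℂ) (k : ℕ) (w : Fin d → ℂ),
      ((Λ - μ • 1) ^ k) w = ((complexEnd A - μ • 1) ^ k) w := by
    intro μ k w
    induction k with
    | zero => rfl
    | succ k ih =>
      rw [pow_succ', pow_succ', mul_apply_eq_comp, Module.End.mul_apply, ih]
      rfl
  let P : (Fin d → ℂ) →L[ℂ] (Fin d → ℂ) :=
    LinearMap.toContinuousLinearMap (E.projection F hcompl)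
  have hP0 : ∀ z, P z = 0 ↔ z ∈ F := fun z => Submodule.projection_apply_eq_zero_iff hcompl
  have hPmem : ∀ z, P z ∈ E := fun z => Submodule.projection_apply_mem hcompl z
  have hPE : ∀ z ∈ E, P z = z := fun z hz => Submodule.projection_apply_of_mem_left hcompl hz
  have hP1 : ∀ z, P z = z ↔ z ∈ E := fun z => ⟨fun h => h ▸ hPmem z, hPE z⟩
  have hPP : ∀ z, P (P z) = P z := fun z => hPE _ (hPmem z)
  have hsub : ∀ z, z - P z ∈ F := fun z => by
    rw [← hP0, map_sub, hPP, sub_self]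
  have hcomm : Commute Λ P := by
    ext1 z
    change Λ (P z) = P (Λ z)
    have h1 : P (Λ (P z)) = Λ (P z) := hPE _ (hinv _ _ (hPmem z))
    have h2 : P (Λ (z - P z)) = 0 := (hP0 _).2 (hinv _ _ (hsub z))
    rw [map_sub, map_sub, h1, sub_eq_zero] at h2
    exact h2.symm
  have hlim1 : ∀ z ∈ E, Filter.Tendsto
      (fun t : ℝ => NormedSpace.exp ((t : ℂ) • -(Λ - (η : ℂ) • 1)) z) Filter.atTop (nhds 0) := by
    let W : Submodule ℂ (Fin d → ℂ) :=
      { carrier := {z | Filter.Tendsto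
          (fun t : ℝ => NormedSpace.exp ((t : ℂ) • -(Λ - (η : ℂ) • 1)) z) Filter.atTop (nhds 0)}
        add_mem' := fun {v w} hv hw => by
          simpa only [Set.mem_ofPred_eq, map_add, add_zero] using hv.add hw
        zero_mem' := by simp
        smul_mem' := fun c w hw => by
          simpa only [Set.mem_ofPred_eq, map_smul, smul_zero] using hw.const_smul c }
    have h : E ≤ W := by
      refine iSup₂_le fun μ hμ w hw => ?_
      obtain ⟨k, hk⟩ := (Module.End.mem_maxGenEigenspace _ _ _).1 hw
      refine tendsto_exp_smul_apply_of_re_neg (μ := -(μ - η)) (k := k) ?_ ?_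
      · have : η < μ.re := hμ
        simpa using this
      · have : -(Λ - (η : ℂ) • 1) - (-(μ - η)) • 1 = -(Λ - μ • 1) := by module
        rw [this, neg_pow, mul_apply_eq_comp, hpow, hk, map_zero]
    exact h
  have hlim2 : ∀ z ∈ F, Filter.Tendsto
      (fun t : ℝ => NormedSpace.exp ((t : ℂ) • (Λ - (η : ℂ) • 1)) z) Filter.atTop (nhds 0) := by
    let W : Submodule ℂ (Fin d → ℂ) :=
      { carrier := {z | Filter.Tendsto
          (fun t : ℝ => NormedSpace.exp ((t : ℂ) • (Λ - (η : ℂ) • 1)) z) Filter.atTop (nhds 0)}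
        add_mem' := fun {v w} hv hw => by
          simpa only [Set.mem_ofPred_eq, map_add, add_zero] using hv.add hw
        zero_mem' := by simp
        smul_mem' := fun c w hw => by
          simpa only [Set.mem_ofPred_eq, map_smul, smul_zero] using hw.const_smul c }
    have h : F ≤ W := by
      refine iSup₂_le fun μ hμ w hw => ?_
      obtain ⟨k, hk⟩ := (Module.End.mem_maxGenEigenspace _ _ _).1 hw
      refine tendsto_exp_smul_apply_of_re_neg (μ := μ - η) (k := k) ?_ ?_
      · have : μ.re < η := hμ
        simpa using this
      · have : Λ - (η : ℂ) • 1 - (μ - η) • 1 = Λ - μ • 1 := by module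
        rw [this, hpow, hk]
    exact h
  refine ⟨P.restrictScalars ℝ, hP0, hP1, ?_⟩
  obtain ⟨T, hT, h⟩ := exists_forall_norm_sub_le_of_tendsto hPP hcomm
    (fun z => hlim1 _ (hPmem z)) (fun z => hlim2 _ (hsub z))
  refine ⟨T, hT, fun t ht x κ hκ hx => ?_⟩
  have h1 := h t ht (complexify d x) κ hκ hx
  rw [← complexify_exp] at h1
  exact h1

/-- A direction outside the central subspace is not joined to a direction of the central subspace by
chains in both directions: along chains an unstable component is not lost, and from vectors of the
central subspace a stable component is not gained. -/
theorem not_mutual_chainLimitSet_of_notMem_centralSubspace {A : Matrix (Fin d) (Fin d) ℝ}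
    {x y : Metric.sphere (0 : EuclideanSpace ℝ (Fin d)) 1}
    (hx : (x : EuclideanSpace ℝ (Fin d)) ∉ centralSubspace A)
    (hy : (y : EuclideanSpace ℝ (Fin d)) ∈ centralSubspace A) :
    ¬(sphereToProj y ∈ chainLimitSet (matrixFlow A).projFlow (sphereToProj x) ∧
      sphereToProj x ∈ chainLimitSet (matrixFlow A).projFlow (sphereToProj y)) := by
  rintro ⟨hxy, hyx⟩
  have hfin : (spectrum ℂ (A.map (fun r : ℝ => (r : ℂ)))).Finite := Matrix.finite_spectrum _
  have hgap : ∀ᶠ η : ℝ in nhdsWithin 0 (Set.Ioi 0),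
      ∀ μ ∈ spectrum ℂ (A.map (fun r : ℝ => (r : ℂ))), μ.re ≠ 0 → η < |μ.re| := by
    rw [Filter.eventually_all_finite hfin]
    intro μ _
    by_cases h : μ.re = 0
    · exact Filter.Eventually.of_forall fun η h' => absurd h h'
    · have := nhdsWithin_le_nhds (s := Set.Ioi (0 : ℝ)) (eventually_lt_nhds (abs_pos.2 h))
      filter_upwards [this] with η hη _ using hη
  obtain ⟨η, hgap, hη⟩ := (hgap.and self_mem_nhdsWithin).exists
  have hη : 0 < η := hη
  have hcy := complexify_mem_of_mem_centralSubspace hy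
  have hcy0 : complexify d y ≠ 0 := by
    intro h
    have := reVec_complexify (y : EuclideanSpace ℝ (Fin d))
    rw [h, map_zero] at this
    exact ne_zero_of_mem_unit_sphere y this.symm
  have hbound : ∀ (P : (Fin d → ℂ) →L[ℝ] (Fin d → ℂ)) (v : EuclideanSpace ℝ (Fin d)),
      ‖v‖ ≤ ‖reVec d‖ * (‖P.comp (complexify d) v‖ +
        ‖(complexify d - P.comp (complexify d)) v‖) := by
    intro P v
    have h1 : complexify d v = P.comp (complexify d) v +
        (complexify d - P.comp (complexify d)) v := by simp
    calc ‖v‖ = ‖reVec d (complexify d v)‖ := by rw [reVec_complexify]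
      _ ≤ ‖reVec d‖ * ‖complexify d v‖ := (reVec d).le_opNorm _
      _ ≤ _ := by
        rw [h1]
        gcongr
        exact norm_add_le _ _
  obtain ⟨P, hP0, -, hPd⟩ := exists_dominated_projection (A := A) (η := η) fun μ hμ h => by
    have := hgap μ hμ (by rw [h]; exact hη.ne')
    rw [h, abs_of_pos hη] at this
    exact lt_irrefl _ this
  obtain ⟨P', -, hP1, hPd'⟩ := exists_dominated_projection (A := A) (η := -η) fun μ hμ h => by
    have := hgap μ hμ (by rw [h]; exact (neg_neg_of_pos hη).ne)
    rw [h, abs_neg, abs_of_pos hη] at this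
    exact lt_irrefl _ this
  have hyP : P (complexify d y) = 0 := (hP0 _).2 (genEigenspaceSum_mono A (fun μ hμ => by
    have h : μ.re = 0 := hμ
    change μ.re < η
    rwa [h]) hcy)
  have hyP' : P' (complexify d y) = complexify d y :=
      (hP1 _).2 (genEigenspaceSum_mono A (fun μ hμ => by
    have h : μ.re = 0 := hμ
    change -η < μ.re
    rw [h]
    linarith) hcy)
  by_cases hxP : P (complexify d x) = 0
  · have hxP' : P' (complexify d x) ≠ complexify d x := by
      intro h
      refine hx (mem_centralSubspace_of_complexify_mem ?_)
      have h1 := genEigenspaceSum_inf_le A _ _ ⟨(hP0 _).1 hxP, (hP1 _).1 h⟩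
      refine (iSup₂_le fun μ hμ => ?_ : genEigenspaceSum A _ ≤ _) h1
      have hμ1 : μ.re < η := hμ.1
      have hμ2 : -η < μ.re := hμ.2
      by_cases hs : μ ∈ spectrum ℂ (A.map (fun r : ℝ => (r : ℂ)))
      · refine maxGenEigenspace_le_genEigenspaceSum A ?_
        by_contra h0
        exact (hgap μ hs h0).not_gt (abs_lt.2 ⟨hμ2, hμ1⟩)
      · rw [maxGenEigenspace_eq_bot_of_notMem_spectrum hs]
        exact bot_le
    have hpos : 0 < ‖complexify d x - P' (complexify d x)‖ :=
      norm_pos_iff.2 (sub_ne_zero.2 hxP'.symm)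
    have hq : 0 ≤ ‖P' (complexify d x)‖ := norm_nonneg _
    refine hPd'.notMem_chainLimitSet (hbound P')
      (κ := ‖complexify d x - P' (complexify d x)‖ / (‖P' (complexify d x)‖ + 1))
      (by positivity) (x := y) (y := x) ?_ ?_ hyx
    · change ‖complexify d y - P' (complexify d y)‖ ≤ _
      rw [hyP', sub_self, norm_zero]
      positivity
    · change _ * ‖P' (complexify d x)‖ < ‖complexify d x - P' (complexify d x)‖
      rw [div_mul_eq_mul_div, div_lt_iff₀ (by positivity)]
      nlinarith
  · have hpos : 0 < ‖P (complexify d x)‖ := norm_pos_iff.2 hxP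
    refine hPd.notMem_chainLimitSet (hbound P)
      (κ := ‖complexify d x - P (complexify d x)‖ / ‖P (complexify d x)‖ + 1)
      (by positivity) (x := x) (y := y) ?_ ?_ hxy
    · change ‖complexify d x - P (complexify d x)‖ ≤ _ * ‖P (complexify d x)‖
      rw [add_mul, div_mul_cancel₀ _ hpos.ne']
      linarith
    · change _ * ‖P (complexify d y)‖ < ‖complexify d y - P (complexify d y)‖
      rw [hyP, norm_zero, mul_zero, sub_zero]
      exact norm_pos_iff.2 hcy0

end Central

/-! ### Cones and their projections -/

section Cones

variable {F : Type*} [NormedAddCommGroup F] [NormedSpace ℝ F]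

theorem sphereToProj_mem_projOfSubspace {V : Submodule ℝ F} {v : Metric.sphere (0 : F) 1} :
    sphereToProj v ∈ projOfSubspace V ↔ (v : F) ∈ V := by
  change (Projectivization.mk ℝ (v : F) _).submodule ≤ V ↔ _
  rw [Projectivization.submodule_mk, Submodule.span_singleton_le_iff_mem]

theorem image_sphereToProj_eq_projOfSubspace (V : Submodule ℝ F) :
    sphereToProj '' sphereSection (V : Set F) = projOfSubspace V := by
  ext p
  obtain ⟨v, rfl⟩ := sphereToProj_surjective p
  refine ⟨?_, fun h => ⟨v, sphereToProj_mem_projOfSubspace.1 h, rfl⟩⟩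
  rintro ⟨w, hw, h⟩
  rw [← h]
  exact sphereToProj_mem_projOfSubspace.2 hw

/-- A cone is determined by its intersection with the unit sphere. -/
theorem IsPositiveCone.subset_of_sphereSection_subset {K K' : Set F} (hK : IsPositiveCone K)
    (hK' : IsPositiveCone K') (h : sphereSection K ⊆ sphereSection K') : K ⊆ K' := by
  intro v hv
  have hv0 : v ≠ 0 := fun h0 => hK.1 (h0 ▸ hv)
  have hpos := norm_pos_iff.2 hv0
  have hmem : (⟨‖v‖⁻¹ • v, by
      rw [mem_sphere_zero_iff_norm, norm_smul, norm_inv, norm_norm, inv_mul_cancel₀ hpos.ne']⟩ :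
      Metric.sphere (0 : F) 1) ∈ sphereSection K := hK.2 _ (inv_pos.2 hpos) v hv
  have h1 := hK'.2 ‖v‖ hpos _ (h hmem)
  rwa [smul_smul, mul_inv_cancel₀ hpos.ne', one_smul] at h1

theorem IsPositiveCone.eq_of_sphereSection_eq {K K' : Set F} (hK : IsPositiveCone K)
    (hK' : IsPositiveCone K') (h : sphereSection K = sphereSection K') : K = K' :=
  (hK.subset_of_sphereSection_subset hK' h.subset).antisymm
    (hK'.subset_of_sphereSection_subset hK h.superset)

theorem isPositiveCone_submodule_diff_zero (V : Submodule ℝ F) :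
    IsPositiveCone {v : F | v ∈ V ∧ v ≠ 0} :=
  ⟨fun h => h.2 rfl, fun c hc _ hv => ⟨V.smul_mem c hv.1, smul_ne_zero hc.ne' hv.2⟩⟩

theorem sphereSection_submodule_diff_zero (V : Submodule ℝ F) :
    sphereSection {v : F | v ∈ V ∧ v ≠ 0} = sphereSection (V : Set F) := by
  ext v
  exact ⟨fun h => h.1, fun h => ⟨h, ne_zero_of_mem_unit_sphere v⟩⟩

/-- The open ray spanned by `v`. -/
def openRay (v : F) : Set F := {w | ∃ c : ℝ, 0 < c ∧ w = c • v}

theorem isPositiveCone_openRay {v : F} (hv : v ≠ 0) : IsPositiveCone (openRay v) := by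
  refine ⟨?_, ?_⟩
  · rintro ⟨c, hc, h⟩
    exact smul_ne_zero hc.ne' hv h.symm
  · rintro b hb _ ⟨c, hc, rfl⟩
    exact ⟨b * c, mul_pos hb hc, smul_smul b c v⟩

theorem sphereSection_openRay (v : Metric.sphere (0 : F) 1) :
    sphereSection (openRay (v : F)) = {v} := by
  ext w
  refine ⟨?_, ?_⟩
  · rintro ⟨c, hc, h⟩
    have h1 := congrArg norm h
    rw [norm_smul, norm_eq_of_mem_sphere v, norm_eq_of_mem_sphere w, mul_one,
      Real.norm_of_nonneg hc.le] at h1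
    rw [← h1, one_smul] at h
    exact Subtype.ext h
  · rintro rfl
    exact ⟨1, one_pos, (one_smul _ _).symm⟩

theorem continuous_poincareProj : Continuous (poincareProj (F := F)) := by
  have hc : Continuous fun v : F => WithLp.toLp 2 (v, (1 : ℝ)) :=
    (WithLp.prod_continuous_toLp 2 F ℝ).comp (continuous_id.prodMk continuous_const)
  have h0 : ∀ v : F, ‖WithLp.toLp 2 (v, (1 : ℝ))‖ ≠ 0 := by
    intro v
    refine norm_ne_zero_iff.2 fun h => ?_
    have := congrArg WithLp.snd h
    simp at this
  exact Continuous.subtype_mk (Continuous.subtype_mk ((hc.norm.inv₀ h0).smul hc) _) _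

/-- The closure of the image of a cone on the Poincaré sphere contains the image of the apex, and
adding the apex makes the cone star-shaped. -/
theorem IsPositiveCone.isPreconnected_closure_image_poincareProj {K : Set F}
    (hK : IsPositiveCone K) (hne : K.Nonempty) :
    IsPreconnected (closure (poincareProj '' K)) := by
  have h0 : (0 : F) ∈ closure K := by
    obtain ⟨v, hv⟩ := hne
    have hlim : Filter.Tendsto (fun c : ℝ => c • v) (nhdsWithin 0 (Set.Ioi 0)) (nhds 0) := by
      have h : Continuous fun c : ℝ => c • v := continuous_id.smul continuous_const
      have h1 := h.tendsto 0
      rw [zero_smul] at h1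
      exact h1.mono_left nhdsWithin_le_nhds
    refine mem_closure_of_tendsto hlim ?_
    filter_upwards [self_mem_nhdsWithin] with c hc using hK.2 c hc v hv
  have hsub : insert 0 K ⊆ closure K := Set.insert_subset h0 subset_closure
  have hstar : StarConvex ℝ 0 (insert 0 K) := by
    rw [starConvex_zero_iff]
    rintro v (rfl | hv) a ha -
    · simp
    · rcases ha.eq_or_lt with rfl | ha
      · simp
      · exact Set.mem_insert_of_mem _ (hK.2 a ha v hv)
  have hpre : IsPreconnected (insert 0 K) :=
    (hstar.isPathConnected (Set.mem_insert _ _)).isConnected.isPreconnected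
  refine (hpre.image poincareProj continuous_poincareProj.continuousOn).subset_closure ?_
    (closure_mono (Set.image_mono (Set.subset_insert _ _)))
  exact (Set.image_mono hsub).trans (image_closure_subset_closure_image continuous_poincareProj)

/-- The unit sphere of a subspace of dimension at least two is connected; a line meets the unit
sphere in a pair of antipodal points. -/
theorem isPreconnected_sphere_or_exists_eq_or_eq_neg {V : Submodule ℝ F} (hV : V ≠ ⊥) :
    IsPreconnected (sphereSection (V : Set F)) ∨
      ∃ v : Metric.sphere (0 : F) 1, (v : F) ∈ V ∧
        ∀ w : Metric.sphere (0 : F) 1, (w : F) ∈ V → w = v ∨ w = -v := by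
  by_cases h : 1 < Module.rank ℝ V
  · left
    have hpre : PreconnectedSpace (Metric.sphere (0 : V) 1) :=
      Subtype.preconnectedSpace (isPreconnected_sphere h 0 1)
    let f : Metric.sphere (0 : V) 1 → Metric.sphere (0 : F) 1 := fun v =>
      ⟨((v : V) : F), by
        have := norm_eq_of_mem_sphere v
        rw [mem_sphere_zero_iff_norm]
        exact this⟩
    have hf : Continuous f :=
      (continuous_subtype_val.comp continuous_subtype_val).subtype_mk _
    have hrange : Set.range f = sphereSection (V : Set F) := by
      ext v
      refine ⟨?_, fun hv => ⟨⟨⟨v, hv⟩, ?_⟩, rfl⟩⟩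
      · rintro ⟨w, rfl⟩
        exact (w : V).2
      · rw [mem_sphere_zero_iff_norm]
        exact norm_eq_of_mem_sphere v
    rw [← hrange]
    exact isPreconnected_range hf
  · right
    obtain ⟨v₀, hv₀⟩ := (rank_submodule_le_one_iff' V).1 (not_lt.1 h)
    obtain ⟨u, hu, hu0⟩ := Submodule.exists_mem_ne_zero_of_ne_bot hV
    have hpos := norm_pos_iff.2 hu0
    let v : Metric.sphere (0 : F) 1 := ⟨‖u‖⁻¹ • u, by
      rw [mem_sphere_zero_iff_norm, norm_smul, norm_inv, norm_norm, inv_mul_cancel₀ hpos.ne']⟩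
    have hv : (v : F) ∈ V := V.smul_mem _ hu
    refine ⟨v, hv, fun w hw => ?_⟩
    obtain ⟨a, ha⟩ := Submodule.mem_span_singleton.1 (hv₀ hv)
    obtain ⟨b, hb⟩ := Submodule.mem_span_singleton.1 (hv₀ hw)
    have ha0 : a ≠ 0 := by
      rintro rfl
      rw [zero_smul] at ha
      exact ne_zero_of_mem_unit_sphere v ha.symm
    refine sphereToProj_eq_iff.1 ((Projectivization.mk_eq_mk_iff' ℝ _ _ _ _).2 ⟨b * a⁻¹, ?_⟩)
    rw [← ha, smul_smul, mul_assoc, inv_mul_cancel₀ ha0, mul_one, hb]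

end Cones

/-! ### Chain transitivity of the central subspace -/

section Main

variable {d : ℕ} {A : Matrix (Fin d) (Fin d) ℝ}

theorem isLinearlyChainRecurrent_of_mem_centralSubspace {x : EuclideanSpace ℝ (Fin d)}
    (hx : x ∈ centralSubspace A) : (matrixFlow A).IsLinearlyChainRecurrent x := by
  obtain ⟨s, hs, h⟩ := exists_aeval_prod_eq_zero_of_mem_centralSubspace hx
  exact isLinearlyChainRecurrent_of_aeval_eq_zero hs h

theorem isChainTransitive_singleton_of_mem_centralSubspace
    {v : Metric.sphere (0 : EuclideanSpace ℝ (Fin d)) 1}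
    (hv : (v : EuclideanSpace ℝ (Fin d)) ∈ centralSubspace A) :
    IsChainTransitive (matrixFlow A).sphereFlow {v} := by
  rintro a rfl b rfl
  exact (isLinearlyChainRecurrent_of_mem_centralSubspace hv).mem_chainLimitSet_sphereFlow

theorem isChainTransitive_closure_image_poincareProj {K : Set (EuclideanSpace ℝ (Fin d))}
    (hK : IsPositiveCone K) (hne : K.Nonempty) (hKV : K ⊆ centralSubspace A) :
    IsChainTransitive (matrixFlow A).hemisphereFlow (closure (poincareProj '' K)) := by
  refine isChainTransitive_of_isPreconnected
    (hK.isPreconnected_closure_image_poincareProj hne) fun z hz => ?_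
  refine LinearFlow.IsLinearlyChainRecurrent.mem_chainLimitSet_hemisphereFlow
    (isLinearlyChainRecurrent_of_mem_centralSubspace ?_)
  have hc : Continuous fun z : closedUpperHemisphere (EuclideanSpace ℝ (Fin d)) =>
      (z : WithLp 2 (EuclideanSpace ℝ (Fin d) × ℝ)).fst :=
    (WithLp.continuous_fst 2 _ ℝ).comp (continuous_subtype_val.comp continuous_subtype_val)
  have hcl : IsClosed {z : closedUpperHemisphere (EuclideanSpace ℝ (Fin d)) |
      (z : WithLp 2 (EuclideanSpace ℝ (Fin d) × ℝ)).fst ∈ centralSubspace A} :=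
    (centralSubspace A).closed_of_finiteDimensional.preimage hc
  refine closure_minimal ?_ hcl hz
  rintro _ ⟨v, hv, rfl⟩
  exact (centralSubspace A).smul_mem _ (hKV hv)

/-- Either the unit sphere of the central subspace is chain transitive, or it is a pair of antipodal
points. -/
theorem isChainTransitive_sphere_or_exists_eq_or_eq_neg (hV : centralSubspace A ≠ ⊥) :
    IsChainTransitive (matrixFlow A).sphereFlow
      (sphereSection (centralSubspace A : Set (EuclideanSpace ℝ (Fin d)))) ∨
      ∃ v : Metric.sphere (0 : EuclideanSpace ℝ (Fin d)) 1,
        (v : EuclideanSpace ℝ (Fin d)) ∈ centralSubspace A ∧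
        ∀ w : Metric.sphere (0 : EuclideanSpace ℝ (Fin d)) 1,
          (w : EuclideanSpace ℝ (Fin d)) ∈ centralSubspace A → w = v ∨ w = -v :=
  (isPreconnected_sphere_or_exists_eq_or_eq_neg hV).imp_left fun h =>
    isChainTransitive_of_isPreconnected h fun _ hv =>
      (isLinearlyChainRecurrent_of_mem_centralSubspace hv).mem_chainLimitSet_sphereFlow

theorem subset_of_isChainTransitive_projFlow {N : Set (ℙ ℝ (EuclideanSpace ℝ (Fin d)))}
    (hN : IsChainTransitive (matrixFlow A).projFlow N)
    {y : Metric.sphere (0 : EuclideanSpace ℝ (Fin d)) 1}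
    (hy : (y : EuclideanSpace ℝ (Fin d)) ∈ centralSubspace A) (hyN : sphereToProj y ∈ N) :
    N ⊆ projOfSubspace (centralSubspace A) := by
  intro p hp
  obtain ⟨x, rfl⟩ := sphereToProj_surjective p
  rw [sphereToProj_mem_projOfSubspace]
  by_contra hx
  exact not_mutual_chainLimitSet_of_notMem_centralSubspace hx hy
    ⟨hN _ hp _ hyN, hN _ hyN _ hp⟩

theorem subset_of_isChainTransitive_sphereFlow
    {N : Set (Metric.sphere (0 : EuclideanSpace ℝ (Fin d)) 1)}
    (hN : IsChainTransitive (matrixFlow A).sphereFlow N)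
    {y : Metric.sphere (0 : EuclideanSpace ℝ (Fin d)) 1}
    (hy : (y : EuclideanSpace ℝ (Fin d)) ∈ centralSubspace A) (hyN : y ∈ N) :
    N ⊆ sphereSection (centralSubspace A : Set (EuclideanSpace ℝ (Fin d))) := fun _ hx =>
  sphereToProj_mem_projOfSubspace.1 (subset_of_isChainTransitive_projFlow hN.image_sphereToProj hy
    (Set.mem_image_of_mem _ hyN) (Set.mem_image_of_mem _ hx))

theorem isChainRecurrentComponent_projOfSubspace_centralSubspace (hV : centralSubspace A ≠ ⊥) :
    IsChainRecurrentComponent (matrixFlow A).projFlow (projOfSubspace (centralSubspace A)) := by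
  obtain ⟨y, hy⟩ : ∃ y : Metric.sphere (0 : EuclideanSpace ℝ (Fin d)) 1,
      (y : EuclideanSpace ℝ (Fin d)) ∈ centralSubspace A := by
    obtain ⟨u, hu, hu0⟩ := Submodule.exists_mem_ne_zero_of_ne_bot hV
    exact ⟨⟨‖u‖⁻¹ • u, by
      rw [mem_sphere_zero_iff_norm, norm_smul, norm_inv, norm_norm,
        inv_mul_cancel₀ (norm_ne_zero_iff.2 hu0)]⟩, (centralSubspace A).smul_mem _ hu⟩
  have hyP : sphereToProj y ∈ projOfSubspace (centralSubspace A) :=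
    sphereToProj_mem_projOfSubspace.2 hy
  refine ⟨⟨_, hyP⟩, ?_, fun N hN hle => subset_of_isChainTransitive_projFlow hN hy (hle hyP)⟩
  rw [← image_sphereToProj_eq_projOfSubspace]
  rcases isChainTransitive_sphere_or_exists_eq_or_eq_neg hV with h | ⟨v, hv, h⟩
  · exact h.image_sphereToProj
  · have himage :
        sphereToProj '' sphereSection (centralSubspace A : Set (EuclideanSpace ℝ (Fin d))) =
        sphereToProj '' {v} := by
      refine Set.Subset.antisymm ?_
        (Set.image_mono (Set.singleton_subset_iff.2 (show v ∈ sphereSection _ from hv)))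
      rintro _ ⟨w, hw, rfl⟩
      exact ⟨v, rfl, (sphereToProj_eq_iff.2 (h w hw)).symm⟩
    rw [himage]
    exact (isChainTransitive_singleton_of_mem_centralSubspace hv).image_sphereToProj

/-- The cones over the components of the unit sphere that project onto the projective central
subspace. -/
def centralCones (A : Matrix (Fin d) (Fin d) ℝ) : Set (Set (EuclideanSpace ℝ (Fin d))) :=
  {K | IsPositiveCone K ∧ IsChainRecurrentComponent (matrixFlow A).sphereFlow (sphereSection K) ∧
    sphereToProj '' sphereSection K = projOfSubspace (centralSubspace A)}

theorem sphereSection_subset_of_mem_centralCones {K : Set (EuclideanSpace ℝ (Fin d))}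
    (hK : K ∈ centralCones A) :
    sphereSection K ⊆ sphereSection (centralSubspace A : Set (EuclideanSpace ℝ (Fin d))) :=
  fun _ hv => sphereToProj_mem_projOfSubspace.1 (hK.2.2.subset (Set.mem_image_of_mem _ hv))

theorem centralCones_eq_singleton (hV : centralSubspace A ≠ ⊥)
    (h : IsChainTransitive (matrixFlow A).sphereFlow
      (sphereSection (centralSubspace A : Set (EuclideanSpace ℝ (Fin d))))) :
    centralCones A = {{v | v ∈ centralSubspace A ∧ v ≠ 0}} := by
  have hcone := isPositiveCone_submodule_diff_zero (centralSubspace A)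
  have hsec := sphereSection_submodule_diff_zero (centralSubspace A)
  ext K
  rw [Set.mem_singleton_iff]
  constructor
  · intro hK
    refine hK.1.eq_of_sphereSection_eq hcone ?_
    rw [hsec]
    have hsub := sphereSection_subset_of_mem_centralCones hK
    exact hsub.antisymm (hK.2.1.2.2 h hsub)
  · rintro rfl
    refine ⟨hcone, ?_, ?_⟩
    · rw [hsec]
      obtain ⟨p, hp⟩ := (isChainRecurrentComponent_projOfSubspace_centralSubspace hV).1
      rw [← image_sphereToProj_eq_projOfSubspace] at hp
      obtain ⟨y, hy, -⟩ := hp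
      exact ⟨⟨y, hy⟩, h, fun N hN hle => subset_of_isChainTransitive_sphereFlow hN hy (hle hy)⟩
    · rw [hsec, image_sphereToProj_eq_projOfSubspace]

theorem centralCones_eq_pair
    (h : ¬IsChainTransitive (matrixFlow A).sphereFlow
      (sphereSection (centralSubspace A : Set (EuclideanSpace ℝ (Fin d)))))
    {v : Metric.sphere (0 : EuclideanSpace ℝ (Fin d)) 1}
    (hv : (v : EuclideanSpace ℝ (Fin d)) ∈ centralSubspace A)
    (hpair : ∀ w : Metric.sphere (0 : EuclideanSpace ℝ (Fin d)) 1,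
      (w : EuclideanSpace ℝ (Fin d)) ∈ centralSubspace A → w = v ∨ w = -v) :
    centralCones A = {openRay (v : EuclideanSpace ℝ (Fin d)),
      openRay ((-v : Metric.sphere (0 : EuclideanSpace ℝ (Fin d)) 1) :
        EuclideanSpace ℝ (Fin d))} := by
  have hnv : ((-v : Metric.sphere (0 : EuclideanSpace ℝ (Fin d)) 1) : EuclideanSpace ℝ (Fin d)) ∈
      centralSubspace A := by
    rw [coe_neg_sphere]
    exact (centralSubspace A).neg_mem hv
  have hnpair : ∀ w : Metric.sphere (0 : EuclideanSpace ℝ (Fin d)) 1,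
      (w : EuclideanSpace ℝ (Fin d)) ∈ centralSubspace A → w = -v ∨ w = - -v := fun w hw => by
    rw [neg_neg]
    exact (hpair w hw).symm
  -- A chain transitive set meeting the pair of antipodal points is one of the two points.
  have hsingle : ∀ u : Metric.sphere (0 : EuclideanSpace ℝ (Fin d)) 1,
      (u : EuclideanSpace ℝ (Fin d)) ∈ centralSubspace A →
      (∀ w : Metric.sphere (0 : EuclideanSpace ℝ (Fin d)) 1,
        (w : EuclideanSpace ℝ (Fin d)) ∈ centralSubspace A → w = u ∨ w = -u) →
      ∀ N, IsChainTransitive (matrixFlow A).sphereFlow N → u ∈ N → N ⊆ {u} := by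
    intro u hu hup N hN huN w hw
    refine (hup w (subset_of_isChainTransitive_sphereFlow hN hu huN hw)).resolve_right ?_
    rintro rfl
    refine h fun a ha b hb => hN a ?_ b ?_
    · rcases hup a ha with rfl | rfl
      exacts [huN, hw]
    · rcases hup b hb with rfl | rfl
      exacts [huN, hw]
  have hray : ∀ u : Metric.sphere (0 : EuclideanSpace ℝ (Fin d)) 1,
      (u : EuclideanSpace ℝ (Fin d)) ∈ centralSubspace A →
      (∀ w : Metric.sphere (0 : EuclideanSpace ℝ (Fin d)) 1,
        (w : EuclideanSpace ℝ (Fin d)) ∈ centralSubspace A → w = u ∨ w = -u) →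
      openRay (u : EuclideanSpace ℝ (Fin d)) ∈ centralCones A := by
    intro u hu hup
    refine ⟨isPositiveCone_openRay (ne_zero_of_mem_unit_sphere u), ?_, ?_⟩
    · rw [sphereSection_openRay]
      exact ⟨Set.singleton_nonempty u, isChainTransitive_singleton_of_mem_centralSubspace hu,
        fun N hN hle => hsingle u hu hup N hN (hle rfl)⟩
    · rw [sphereSection_openRay, ← image_sphereToProj_eq_projOfSubspace]
      refine (Set.image_mono
        (Set.singleton_subset_iff.2 (show u ∈ sphereSection _ from hu))).antisymm ?_
      rintro _ ⟨w, hw, rfl⟩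
      exact ⟨u, rfl, (sphereToProj_eq_iff.2 (hup w hw)).symm⟩
  have heq : ∀ K ∈ centralCones A, ∀ u : Metric.sphere (0 : EuclideanSpace ℝ (Fin d)) 1,
      (u : EuclideanSpace ℝ (Fin d)) ∈ centralSubspace A →
      (∀ w : Metric.sphere (0 : EuclideanSpace ℝ (Fin d)) 1,
        (w : EuclideanSpace ℝ (Fin d)) ∈ centralSubspace A → w = u ∨ w = -u) →
      u ∈ sphereSection K → K = openRay (u : EuclideanSpace ℝ (Fin d)) := by
    intro K hK u hu hup huK
    refine hK.1.eq_of_sphereSection_eq (isPositiveCone_openRay (ne_zero_of_mem_unit_sphere u)) ?_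
    rw [sphereSection_openRay]
    exact (hsingle u hu hup _ hK.2.1.2.1 huK).antisymm (Set.singleton_subset_iff.2 huK)
  ext K
  rw [Set.mem_insert_iff, Set.mem_singleton_iff]
  constructor
  · intro hK
    obtain ⟨w, hw⟩ := hK.2.1.1
    rcases hpair w (sphereSection_subset_of_mem_centralCones hK hw) with rfl | rfl
    · exact Or.inl (heq K hK _ hv hpair hw)
    · exact Or.inr (heq K hK _ hnv hnpair hw)
  · rintro (rfl | rfl)
    · exact hray v hv hpair
    · exact hray (-v) hnv hnpair

theorem isChainTransitive_closure_of_mem_centralCones {K : Set (EuclideanSpace ℝ (Fin d))}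
    (hK : K ∈ centralCones A) :
    IsChainTransitive (matrixFlow A).hemisphereFlow (closure (poincareProj '' K)) := by
  have hsub := hK.1.subset_of_sphereSection_subset
    (isPositiveCone_submodule_diff_zero (centralSubspace A))
    ((sphereSection_subset_of_mem_centralCones hK).trans
      (sphereSection_submodule_diff_zero _).superset)
  obtain ⟨w, hw⟩ := hK.2.1.1
  exact isChainTransitive_closure_image_poincareProj hK.1 ⟨w, hw⟩ fun v hv => (hsub hv).1

end Main

end

theorem corollary5 (d : ℕ) (A : Matrix (Fin d) (Fin d) ℝ) (hV : centralSubspace A ≠ ⊥) :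
    IsChainRecurrentComponent (matrixFlow A).projFlow (projOfSubspace (centralSubspace A)) ∧
    ∃ Vplus Vminus : Set (EuclideanSpace ℝ (Fin d)),
      {K : Set (EuclideanSpace ℝ (Fin d)) | IsPositiveCone K ∧
        IsChainRecurrentComponent (matrixFlow A).sphereFlow (sphereSection K) ∧
        sphereToProj '' sphereSection K = projOfSubspace (centralSubspace A)} = {Vplus, Vminus} ∧
      IsChainTransitive (matrixFlow A).hemisphereFlow (closure (poincareProj '' Vplus)) ∧
      IsChainTransitive (matrixFlow A).hemisphereFlow (closure (poincareProj '' Vminus)) := by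
  refine ⟨isChainRecurrentComponent_projOfSubspace_centralSubspace hV, ?_⟩
  suffices h : ∃ Vplus Vminus, centralCones A = {Vplus, Vminus} by
    obtain ⟨Vplus, Vminus, h⟩ := h
    exact ⟨Vplus, Vminus, h,
      isChainTransitive_closure_of_mem_centralCones (h.superset (Set.mem_insert _ _)),
      isChainTransitive_closure_of_mem_centralCones
        (h.superset (Set.mem_insert_of_mem _ (Set.mem_singleton _)))⟩
  by_cases hT : IsChainTransitive (matrixFlow A).sphereFlow
      (sphereSection (centralSubspace A : Set (EuclideanSpace ℝ (Fin d))))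
  · exact ⟨_, _, (centralCones_eq_singleton hV hT).trans (Set.pair_eq_singleton _).symm⟩
  · obtain ⟨v, hv, hpair⟩ :=
      (isChainTransitive_sphere_or_exists_eq_or_eq_neg hV).resolve_left hT
    exact ⟨_, _, centralCones_eq_pair hT hv hpair⟩
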